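/- Let $B$ be a smooth curve over $\mathbb C$, let $\mathfrak E=(E,\phi)$ be a Higgs bundle of rank $r$ on $B$, i.e. a locally free sheaf $E$ of rank $r$ with an $\mathcal O_B$-linear map $\phi\colon E\to E\otimes\Omega^1_B$, and let $\rho\colon \mathrm{Hgrass}_1(\mathfrak E)\to B$ be its Higgs Grassmannian of rank-one Higgs subbundles: the closed subscheme of $\mathbb P(E)$ (the bundle of lines in $E$) of $\phi$-invariant lines which, in a local frame $e_1,\dots,e_r$ of $E$ with $\phi(e_j)=\sum_i \phi_{ij}\,e_i\otimes\omega$, where $\omega$ generates $\Omega^1_B$ and $z_1,\dots,z_r$ are the homogeneous coordinates of the line spanned by $\sum_i z_ie_i$, has the equations $$\sum_{k=1}^r z_k(\phi_{jk}z_i-\phi_{ik}z_j)=0,\qquad 1\le i<j\le r.$$ Let $U\subseteq B$ be a nonempty open subset on which the Jordan type of $\phi$ is constant, given by $$\bigl((\lambda_v,i_{vj})^{m_{vj}}\ \big|\ 1\le v\le s,\ 1\le j\le j_v\bigr),$$ where $\lambda_v\in H^0(U,\Omega^1_B)$, the $j_v,i_{vj},m_{vj}$ are positive integers, and $i_{vj}\ne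 i_{vj'}$ for $j\neq j'$. This means that at every closed point $p\in U$ the values $\lambda_1(p),\dots,\lambda_s(p)$ are pairwise distinct and the Jordan normal form of $\phi(p)$ (both taken with respect to a local generator of $\Omega^1_B$) consists, for all $v,j$, of exactly $m_{vj}$ blocks of size $i_{vj}$ with eigenvalue $\lambda_v(p)$. Write $\mathrm{Hgrass}_1(\mathfrak E_{|U})=\rho^{-1}(U)$. Then: 1. The morphism $\mathrm{Hgrass}_1(\mathfrak E_{|U})\to U$ is finite if and only if the eigenvalues of the Jordan blocks of $\phi$ (one eigenvalue for each block, every block counted as often as its multiplicity says) are pairwise distinct, i.e. for each $v$ there is only one Jordan block with eigenvalue $\lambda_v$. 2. The scheme $\mathrm{Hgrass}_1(\mathfrak E_{|U})$ is reduced if and only if $\phi$ is diagonalizable on $U$, i.e. every point of $U$ has an open neighbourhood with a frame $e_1,\dots,e_r$ of $E$ and one-forms $\omega_1,\dots,\omega_r$ such that $\phi(e_i)=e_i\otimes\omega_i$ for all $i$. -/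

import Mathlib

open AlgebraicGeometry CategoryTheory HomogeneousLocalization

section ProjBaseChange

/-- The structure morphism `Proj 𝒜 ⟶ Spec A` of the `Proj` of a graded `A`-algebra. -/
noncomputable def projToSpec {A R : Type} [CommRing A] [CommRing R] [Algebra A R]
    (𝒜 : ℕ → Submodule A R) [GradedAlgebra 𝒜] : Proj 𝒜 ⟶ Spec (.of A) :=
  Proj.toSpecZero 𝒜 ≫ Spec.map (CommRingCat.ofHom (algebraMap A (𝒜 0)))

variable {A A' R R' : Type} [CommRing A] [CommRing A'] [CommRing R] [CommRing R']
  [Algebra A R] [Algebra A' R'] {𝒜 : ℕ → Submodule A R} {ℬ : ℕ → Submodule A' R'}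

theorem awayι_projToSpec [GradedAlgebra 𝒜] {i : ℕ} (hi : 0 < i) (s : R) (hs : s ∈ 𝒜 i) :
    Proj.awayι 𝒜 s hs hi ≫ projToSpec 𝒜 = Spec.map (CommRingCat.ofHom
      ((fromZeroRingHom 𝒜 (Submonoid.powers s)).comp (algebraMap A (𝒜 0)))) := by
  rw [projToSpec, Proj.awayι_toSpecZero_assoc, ← Spec.map_comp]
  rfl

/-- A graded ring homomorphism `F`, lying over the ring homomorphism `ρ`, which exhibits its
target as the localization of its source at `f`, where `ρ` is the localization at `f`. -/
structure IsGradedLocalization (F : 𝒜 →+*ᵍ ℬ) (ρ : A →+* A') (f : A) : Prop where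
  comm : ∀ a, F (algebraMap A R a) = algebraMap A' R' (ρ a)
  base : letI := ρ.toAlgebra; IsLocalization.Away f A'
  surj : ∀ y : R', ∃ (n : ℕ) (x : R), algebraMap A' R' (ρ f) ^ n * y = F x
  inj : ∀ x : R, F x = 0 → ∃ n : ℕ, algebraMap A R f ^ n * x = 0

namespace IsGradedLocalization

variable {F : 𝒜 →+*ᵍ ℬ} {ρ : A →+* A'} {f : A}

theorem isUnit (h : IsGradedLocalization F ρ f) : IsUnit (ρ f) := by
  let _ := ρ.toAlgebra
  have := h.base
  exact IsLocalization.Away.algebraMap_isUnit (S := A') f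

variable [GradedAlgebra 𝒜] [GradedAlgebra ℬ]

theorem surj_homogeneous (h : IsGradedLocalization F ρ f) (i : ℕ) (y : R') (hy : y ∈ ℬ i) :
    ∃ (n : ℕ) (x : R), x ∈ 𝒜 i ∧ algebraMap A' R' (ρ f) ^ n * y = F x := by
  obtain ⟨n, x, hx⟩ := h.surj y
  refine ⟨n, (DirectSum.decompose 𝒜 x i : R), SetLike.coe_mem _, ?_⟩
  have h1 : algebraMap A' R' (ρ f) ^ n * y ∈ ℬ i := by
    rw [← map_pow, ← Algebra.smul_def]
    exact Submodule.smul_mem _ _ hy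
  rw [← DirectSum.decompose_of_mem_same ℬ h1, hx]
  exact (_root_.map_directSumDecompose 𝒜 ℬ F (i := i) (x := x)).symm

theorem irrelevant_le (h : IsGradedLocalization F ρ f) :
    HomogeneousIdeal.irrelevant ℬ ≤ (HomogeneousIdeal.irrelevant 𝒜).map F := by
  rw [HomogeneousIdeal.irrelevant_le]
  intro i hi y hy
  obtain ⟨n, x, hx, hxy⟩ := h.surj_homogeneous i y hy
  have hu : IsUnit (algebraMap A' R' (ρ f) ^ n) := (h.isUnit.map _).pow n
  change y ∈ (HomogeneousIdeal.irrelevant 𝒜).toIdeal.map F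
  rw [← Ideal.unit_mul_mem_iff_mem _ hu, hxy]
  exact Ideal.mem_map_of_mem F (HomogeneousIdeal.mem_irrelevant_of_mem _ hi hx)

/-- The map on homogeneous localizations induced by a graded localization is a localization. -/
theorem isPushout_away (h : IsGradedLocalization F ρ f) {i : ℕ} (s : R) (hs : s ∈ 𝒜 i) :
    IsPushout (CommRingCat.ofHom
        ((fromZeroRingHom 𝒜 (Submonoid.powers s)).comp (algebraMap A (𝒜 0))))
      (CommRingCat.ofHom ρ) (CommRingCat.ofHom (Away.map F s))
      (CommRingCat.ofHom
        ((fromZeroRingHom ℬ (Submonoid.powers (F s))).comp (algebraMap A' (ℬ 0)))) := by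
  let _ := ρ.toAlgebra
  have _ := h.base
  let _ := (Away.map F s).toAlgebra
  have hFs : F s ∈ ℬ i := F.map_mem hs
  have hsc : ∀ (a : A) (n : ℕ), algebraMap A R a ^ n ∈ 𝒜 0 := fun a n => by
    rw [← map_pow]; exact SetLike.algebraMap_mem_graded 𝒜 _
  set c := (fromZeroRingHom 𝒜 (Submonoid.powers s)).comp (algebraMap A (𝒜 0)) with hc
  set c' := (fromZeroRingHom ℬ (Submonoid.powers (F s))).comp (algebraMap A' (ℬ 0)) with hc'
  have hval : ∀ a, (c a).val = algebraMap R _ (algebraMap A R a) := fun a => by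
    rw [← Localization.mk_one_eq_algebraMap]
    rfl
  have hval' : ∀ a, (c' a).val = algebraMap R' _ (algebraMap A' R' a) := fun a => by
    rw [← Localization.mk_one_eq_algebraMap]
    rfl
  have hcomm : (Away.map F s).comp c = c'.comp ρ := by
    ext a
    have e : c a = Away.mk 𝒜 hs 0 (algebraMap A R a) (by
      simpa using SetLike.algebraMap_mem_graded 𝒜 a) := by
      apply HomogeneousLocalization.val_injective
      rw [hval, ← Localization.mk_one_eq_algebraMap, Away.val_mk]
      congr 1
      ext; simp
    change ((Away.map F s) (c a)).val = (c' (ρ a)).val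
    rw [hval', e, Away.map_mk, Away.val_mk,
      ← Localization.mk_one_eq_algebraMap, ← h.comm]
    congr 1
    ext; simp
  have : IsLocalization (Submonoid.map c (Submonoid.powers f)) (Away ℬ (F s)) := by
    rw [Submonoid.map_powers]
    refine IsLocalization.Away.mk (c f) ?_ ?_ ?_
    · change IsUnit ((Away.map F s) (c f))
      have := congr($hcomm f)
      simp only [RingHom.comp_apply] at this
      rw [this]
      exact h.isUnit.map c'
    · intro y
      obtain ⟨n, b, hb, rfl⟩ := Away.mk_surjective _ hFs y
      obtain ⟨m, x, hx, hxy⟩ := h.surj_homogeneous _ b hb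
      refine ⟨m, Away.mk 𝒜 hs n x hx, ?_⟩
      change _ * (Away.map F s) (c f) ^ m = (Away.map F s) _
      have e1 : (Away.map F s) (c f) = c' (ρ f) := congr($hcomm f)
      rw [e1, Away.map_mk]
      apply HomogeneousLocalization.val_injective
      rw [HomogeneousLocalization.val_mul, HomogeneousLocalization.val_pow, hval', Away.val_mk,
        Away.val_mk, ← map_pow (algebraMap R' (Localization _)),
        ← Localization.mk_one_eq_algebraMap, Localization.mk_mul, ← hxy]
      congr 1
      · ring
      · exact mul_one _
    · intro y z hyz
      change (Away.map F s) y = (Away.map F s) z at hyz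
      obtain ⟨n, a, ha, rfl⟩ := Away.mk_surjective _ hs y
      obtain ⟨m, b, hb, rfl⟩ := Away.mk_surjective _ hs z
      rw [Away.map_mk, Away.map_mk] at hyz
      replace hyz := congr(HomogeneousLocalization.val $hyz)
      rw [Away.val_mk, Away.val_mk, Localization.mk_eq_mk_iff, Localization.r_iff_exists] at hyz
      obtain ⟨⟨_, k, rfl⟩, hk⟩ := hyz
      simp only [← map_pow, ← map_mul] at hk
      obtain ⟨N, hN⟩ := h.inj (s ^ k * (s ^ m * a) - s ^ k * (s ^ n * b)) (by
        rw [map_sub, hk, sub_self])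
      refine ⟨N, ?_⟩
      apply HomogeneousLocalization.val_injective
      rw [HomogeneousLocalization.val_mul, HomogeneousLocalization.val_mul,
        HomogeneousLocalization.val_pow, hval, Away.val_mk, Away.val_mk, ← map_pow,
        ← Localization.mk_one_eq_algebraMap, Localization.mk_mul, Localization.mk_mul,
        Localization.mk_eq_mk_iff, Localization.r_iff_exists]
      refine ⟨⟨s ^ k, k, rfl⟩, ?_⟩
      simp only [one_mul]
      linear_combination hN
  exact CommRingCat.isPushout_of_isLocalization c c' hcomm.symm (.powers f)

theorem isPullback_awayι (h : IsGradedLocalization F ρ f) {i : ℕ} (hi : 0 < i) (s : R) (hs : s ∈ 𝒜 i) :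
    IsPullback (Spec.map (CommRingCat.ofHom (Away.map F s)))
      (Proj.awayι ℬ (F s) (F.map_mem hs) hi) (Proj.awayι 𝒜 s hs hi)
      (Proj.map F h.irrelevant_le) := by
  have hFs : F s ∈ ℬ i := F.map_mem hs
  have : IsOpenImmersion (Proj.awayι ℬ (F s) hFs hi) := inferInstance
  have : IsOpenImmersion (Proj.awayι 𝒜 s hs hi) := inferInstance
  refine IsOpenImmersion.isPullback _ _ _ _
    (Proj.awayι_comp_map F h.irrelevant_le hi _ hs) ?_
  rw [Proj.opensRange_awayι, Proj.opensRange_awayι]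
  exact Proj.map_preimage_basicOpen _ _ _

theorem isPullback_proj (h : IsGradedLocalization F ρ f) :
    IsPullback (Proj.map F h.irrelevant_le) (projToSpec ℬ) (projToSpec 𝒜)
      (Spec.map (CommRingCat.ofHom ρ)) := by
  refine Scheme.isPullback_of_openCover _ _ _ _ (Proj.affineOpenCover 𝒜).openCover fun s => ?_
  have h1 := ((h.isPushout_away s.2.1 s.2.2).op.map Scheme.Spec)
  have h2 := h.isPullback_awayι s.1.2 s.2.1 s.2.2
  refine IsPullback.of_iso h1.flip h2.flip.isoPullback (Iso.refl _) (Iso.refl _) (Iso.refl _)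
    ?_ ?_ ?_ ?_
  · exact (Category.comp_id _).trans (h2.flip.isoPullback_hom_snd).symm
  · refine (Category.comp_id _).trans ?_
    refine Eq.trans ?_ (Category.assoc _ _ _)
    refine Eq.trans ?_ congr($(h2.flip.isoPullback_hom_fst.symm) ≫ projToSpec ℬ)
    exact (awayι_projToSpec s.1.2 (F s.2.1) (F.map_mem s.2.2)).symm
  · refine (Category.comp_id _).trans (Eq.trans ?_ (Category.id_comp _).symm)
    exact (awayι_projToSpec s.1.2 s.2.1 s.2.2).symm
  · exact (Category.comp_id _).trans (Category.id_comp _).symm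

end IsGradedLocalization
end ProjBaseChange


section HiggsAlgebra

attribute [local instance] MvPolynomial.gradedAlgebra

open MvPolynomial

/-- The quotient of a graded algebra by a homogeneous ideal is graded by the images of the
homogeneous components. -/
theorem exists_gradedAlgebra_quotient {A R : Type} [CommRing A] [CommRing R] [Algebra A R]
    (𝒜 : ℕ → Submodule A R) [GradedAlgebra 𝒜] (I : Ideal R) (hI : I.IsHomogeneous 𝒜) :
    Nonempty (GradedAlgebra fun n => (𝒜 n).map (Ideal.Quotient.mkₐ A I).toLinearMap) := by
  classical
  set 𝒬 : ℕ → Submodule A (R ⧸ I) := fun n => (𝒜 n).map (Ideal.Quotient.mkₐ A I).toLinearMap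
  have hmem : ∀ n (x : 𝒜 n), Ideal.Quotient.mkₐ A I x ∈ 𝒬 n := fun n x => ⟨x, x.2, rfl⟩
  let q : ∀ n, 𝒜 n →ₗ[A] 𝒬 n := fun n =>
    ((Ideal.Quotient.mkₐ A I).toLinearMap ∘ₗ (𝒜 n).subtype).codRestrict _ (hmem n)
  let d0 : R →ₗ[A] DirectSum ℕ (fun n => 𝒬 n) :=
    DirectSum.lmap q ∘ₗ (DirectSum.decomposeLinearEquiv 𝒜).toLinearMap
  have hd0 : ∀ x ∈ I, d0 x = 0 := by
    intro x hx
    refine DFinsupp.ext fun n => ?_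
    have h1 : (DirectSum.decompose 𝒜 x n : R) ∈ I := hI n hx
    have h2 : d0 x n = q n (DirectSum.decompose 𝒜 x n) := by
      rw [LinearMap.comp_apply, DirectSum.lmap_apply]
      rfl
    rw [h2]
    exact Subtype.ext (Ideal.Quotient.eq_zero_iff_mem.mpr h1)
  have hd0' : ∀ n (x : 𝒜 n), d0 x = DirectSum.of (fun n => 𝒬 n) n (q n x) := by
    intro n x
    have : d0 x = DirectSum.lmap q (DirectSum.decompose 𝒜 (x : R)) := rfl
    rw [this, DirectSum.decompose_coe]
    exact DirectSum.lmap_lof q n x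
  let d : (R ⧸ I) →ₗ[A] DirectSum ℕ (fun n => 𝒬 n) :=
    { QuotientAddGroup.lift I.toAddSubgroup d0.toAddMonoidHom hd0 with
      map_smul' := by
        rintro a ⟨x⟩
        exact d0.map_smul a x }
  have hd : ∀ x, d (Ideal.Quotient.mk I x) = d0 x := fun x => rfl
  clear_value d d0
  let dec : DirectSum.Decomposition 𝒬 := DirectSum.Decomposition.ofLinearMap 𝒬 d
    (by
      refine LinearMap.ext fun y => ?_
      obtain ⟨x, rfl⟩ := Ideal.Quotient.mk_surjective y
      rw [LinearMap.comp_apply, hd, LinearMap.id_apply]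
      induction x using DirectSum.Decomposition.inductionOn 𝒜 with
      | zero => simp
      | homogeneous x =>
        rw [hd0']
        exact DirectSum.coeLinearMap_lof _ _ _
      | add x y hx hy => rw [map_add, map_add, map_add, hx, hy])
    (by
      ext n ⟨_, x, hx, rfl⟩ : 2
      rw [LinearMap.comp_apply, LinearMap.comp_apply, DirectSum.coeLinearMap_lof]
      exact (hd x).trans (hd0' n ⟨x, hx⟩))
  have hmon : SetLike.GradedMonoid 𝒬 :=
    { one_mem := ⟨1, SetLike.GradedOne.one_mem, (Ideal.Quotient.mkₐ A I).map_one⟩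
      mul_mem := by
        rintro i j _ _ ⟨x, hx, rfl⟩ ⟨y, hy, rfl⟩
        exact ⟨x * y, SetLike.GradedMul.mul_mem hx hy, (Ideal.Quotient.mkₐ A I).map_mul x y⟩ }
  exact ⟨{ toGradedMonoid := hmon, toDecomposition := dec }⟩

variable {A A' A'' : Type} [CommRing A] [CommRing A'] [CommRing A''] {r : ℕ}

/-- The quadratic form `∑ₖ zₖ (Φⱼₖ zᵢ - Φᵢₖ zⱼ)`. -/
noncomputable def higgsForm (Φ : Matrix (Fin r) (Fin r) A) (i j : Fin r) :
    MvPolynomial (Fin r) A :=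
  ∑ k, X k * (C (Φ j k) * X i - C (Φ i k) * X j)

/-- The homogeneous ideal generated by the quadratic forms `∑ₖ zₖ (Φⱼₖ zᵢ - Φᵢₖ zⱼ)`. -/
noncomputable def higgsIdeal (Φ : Matrix (Fin r) (Fin r) A) : Ideal (MvPolynomial (Fin r) A) :=
  Ideal.span {p | ∃ i j : Fin r, i < j ∧ p = higgsForm Φ i j}

theorem higgsForm_mem (Φ : Matrix (Fin r) (Fin r) A) (i j : Fin r) :
    higgsForm Φ i j ∈ higgsIdeal Φ := by
  rcases lt_trichotomy i j with h | rfl | h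
  · exact Ideal.subset_span ⟨i, j, h, rfl⟩
  · simp [higgsForm]
  · have : higgsForm Φ i j = - higgsForm Φ j i := by
      rw [higgsForm, higgsForm, ← Finset.sum_neg_distrib]
      exact Finset.sum_congr rfl fun k _ => by ring
    rw [this]
    exact neg_mem (Ideal.subset_span ⟨j, i, h, rfl⟩)

theorem isHomogeneous_higgsForm (Φ : Matrix (Fin r) (Fin r) A) (i j : Fin r) :
    (higgsForm Φ i j).IsHomogeneous 2 := by
  refine IsHomogeneous.sum _ _ _ fun k _ => ?_
  refine (isHomogeneous_X A k).mul (n := 1) (IsHomogeneous.sub ?_ ?_)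
  · simpa using (isHomogeneous_C (Fin r) (Φ j k)).mul (isHomogeneous_X A i)
  · simpa using (isHomogeneous_C (Fin r) (Φ i k)).mul (isHomogeneous_X A j)

theorem isHomogeneous_higgsIdeal (Φ : Matrix (Fin r) (Fin r) A) :
    (higgsIdeal Φ).IsHomogeneous (homogeneousSubmodule (Fin r) A) := by
  refine Ideal.homogeneous_span _ _ ?_
  rintro _ ⟨i, j, -, rfl⟩
  exact ⟨2, isHomogeneous_higgsForm Φ i j⟩

/-- The homogeneous coordinate ring `A[z₁, …, zᵣ] / (∑ₖ zₖ (Φⱼₖ zᵢ - Φᵢₖ zⱼ))`. -/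
abbrev HiggsRing (Φ : Matrix (Fin r) (Fin r) A) : Type := MvPolynomial (Fin r) A ⧸ higgsIdeal Φ

/-- The grading of the homogeneous coordinate ring by the degree of polynomials. -/
noncomputable def higgsGrading (Φ : Matrix (Fin r) (Fin r) A) (n : ℕ) : Submodule A (HiggsRing Φ) :=
  (homogeneousSubmodule (Fin r) A n).map (Ideal.Quotient.mkₐ A (higgsIdeal Φ)).toLinearMap

noncomputable instance (Φ : Matrix (Fin r) (Fin r) A) : GradedAlgebra (higgsGrading Φ) :=
  (exists_gradedAlgebra_quotient _ _ (isHomogeneous_higgsIdeal Φ)).some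

/-- The ring homomorphism of polynomial rings over `ρ` given by the linear substitution
`zⱼ ↦ ∑ᵢ hⱼᵢ zᵢ`. -/
noncomputable def linearSubst (ρ : A →+* A') (h : Matrix (Fin r) (Fin r) A') :
    MvPolynomial (Fin r) A →+* MvPolynomial (Fin r) A' :=
  eval₂Hom (C.comp ρ) fun j => ∑ i, C (h j i) * X i

/-- `h` is an invertible matrix which transforms `Φ` into `Φ'`, up to a unit. -/
structure IsFrameChange (Φ : Matrix (Fin r) (Fin r) A) (Φ' : Matrix (Fin r) (Fin r) A')
    (ρ : A →+* A') (h : Matrix (Fin r) (Fin r) A') : Prop where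
  exists_inv : ∃ g : Matrix (Fin r) (Fin r) A', h * g = 1 ∧ g * h = 1
  conj : ∃ u : A', IsUnit u ∧ h * Φ' = u • (Φ.map ρ * h)

@[simp]
theorem linearSubst_X (ρ : A →+* A') (h : Matrix (Fin r) (Fin r) A') (j : Fin r) :
    linearSubst ρ h (X j) = ∑ i, C (h j i) * X i := by
  simp [linearSubst]

@[simp]
theorem linearSubst_C (ρ : A →+* A') (h : Matrix (Fin r) (Fin r) A') (a : A) :
    linearSubst ρ h (C a) = C (ρ a) := by
  simp [linearSubst]

theorem higgsForm_eq (Φ : Matrix (Fin r) (Fin r) A) (i j : Fin r) :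
    higgsForm Φ i j = (∑ k, C (Φ j k) * X k) * X i - (∑ k, C (Φ i k) * X k) * X j := by
  rw [higgsForm, Finset.sum_mul, Finset.sum_mul, ← Finset.sum_sub_distrib]
  exact Finset.sum_congr rfl fun k _ => by ring

theorem linearSubst_higgsForm (Φ : Matrix (Fin r) (Fin r) A) (Φ' : Matrix (Fin r) (Fin r) A')
    (ρ : A →+* A') (h : Matrix (Fin r) (Fin r) A') (u : A') (hu : h * Φ' = u • (Φ.map ρ * h))
    (i j : Fin r) :
    C u * linearSubst ρ h (higgsForm Φ i j) =
      ∑ k, ∑ l, C (h i k * h j l) * higgsForm Φ' k l := by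
  have key : ∀ j, C u * ∑ k, C (ρ (Φ j k)) * ∑ i, C (h k i) * X i =
      ∑ m, C (h j m) * ∑ l, C (Φ' m l) * X (R := A') l := by
    intro j
    have h1 : ∀ l, ∑ m, h j m * Φ' m l = u * ∑ k, ρ (Φ j k) * h k l := fun l => by
      simpa [Matrix.mul_apply] using congrFun (congrFun hu j) l
    simp only [Finset.mul_sum]
    rw [Finset.sum_comm]
    conv_rhs => rw [Finset.sum_comm]
    refine Finset.sum_congr rfl fun l _ => ?_
    simp only [← mul_assoc, ← C_mul]
    rw [← Finset.sum_mul, ← Finset.sum_mul, ← map_sum, ← map_sum, h1, Finset.mul_sum]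
    simp only [mul_assoc]
  simp only [higgsForm_eq, map_sub, map_mul, map_sum, linearSubst_X, linearSubst_C]
  rw [mul_sub, ← mul_assoc, ← mul_assoc, key, key, Finset.sum_mul_sum, Finset.sum_mul_sum,
    Finset.sum_comm]
  rw [← Finset.sum_sub_distrib]
  refine Finset.sum_congr rfl fun k _ => ?_
  rw [← Finset.sum_sub_distrib]
  exact Finset.sum_congr rfl fun l _ => by ring

theorem linearSubst_mem (Φ : Matrix (Fin r) (Fin r) A) (Φ' : Matrix (Fin r) (Fin r) A')
    (ρ : A →+* A') (h : Matrix (Fin r) (Fin r) A') (H : IsFrameChange Φ Φ' ρ h) :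
    higgsIdeal Φ ≤ (higgsIdeal Φ').comap (linearSubst ρ h) := by
  obtain ⟨u, hu, hh⟩ := H.conj
  rw [higgsIdeal, Ideal.span_le]
  rintro _ ⟨i, j, -, rfl⟩
  rw [SetLike.mem_coe, Ideal.mem_comap, ← Ideal.unit_mul_mem_iff_mem _ (hu.map C),
    linearSubst_higgsForm Φ Φ' ρ h u hh]
  exact sum_mem fun k _ => sum_mem fun l _ => Ideal.mul_mem_left _ _ (higgsForm_mem _ _ _)

theorem linearSubst_isHomogeneous (ρ : A →+* A') (h : Matrix (Fin r) (Fin r) A') {n : ℕ}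
    {p : MvPolynomial (Fin r) A} (hp : p.IsHomogeneous n) :
    (linearSubst ρ h p).IsHomogeneous n := by
  have := hp.eval₂ (C.comp ρ) (fun j => ∑ i, C (h j i) * X i) (n := 1)
    (fun a => by simpa using isHomogeneous_C (Fin r) (ρ a))
    (fun j => IsHomogeneous.sum _ _ _ fun i _ => by
      simpa using (isHomogeneous_C (Fin r) (h j i)).mul (isHomogeneous_X A' i))
  rw [one_mul] at this
  exact this

/-- The graded homomorphism of homogeneous coordinate rings induced by a change of frame. -/
noncomputable def higgsMap {Φ : Matrix (Fin r) (Fin r) A} {Φ' : Matrix (Fin r) (Fin r) A'}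
    {ρ : A →+* A'} {h : Matrix (Fin r) (Fin r) A'} (H : IsFrameChange Φ Φ' ρ h) :
    higgsGrading Φ →+*ᵍ higgsGrading Φ' where
  toRingHom := Ideal.quotientMap _ (linearSubst ρ h) (linearSubst_mem _ _ _ _ H)
  map_mem := by
    rintro n _ ⟨p, hp, rfl⟩
    exact ⟨linearSubst ρ h p, linearSubst_isHomogeneous ρ h hp, rfl⟩

theorem higgsMap_mk {Φ : Matrix (Fin r) (Fin r) A} {Φ' : Matrix (Fin r) (Fin r) A'}
    {ρ : A →+* A'} {h : Matrix (Fin r) (Fin r) A'} (H : IsFrameChange Φ Φ' ρ h)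
    (p : MvPolynomial (Fin r) A) :
    higgsMap H (Ideal.Quotient.mk _ p) = Ideal.Quotient.mk _ (linearSubst ρ h p) := rfl

theorem linearSubst_linearSubst (ρ : A →+* A') (h : Matrix (Fin r) (Fin r) A')
    (ρ' : A' →+* A'') (h' : Matrix (Fin r) (Fin r) A'') (p : MvPolynomial (Fin r) A) :
    linearSubst ρ' h' (linearSubst ρ h p) = linearSubst (ρ'.comp ρ) (h.map ρ' * h') p := by
  induction p using MvPolynomial.induction_on with
  | C a => simp
  | add p q hp hq => simp only [map_add, hp, hq]
  | mul_X p j hp =>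
    rw [map_mul, map_mul, map_mul, hp]
    refine congrArg _ ?_
    simp only [linearSubst_X, map_sum, map_mul, linearSubst_C, Finset.mul_sum]
    rw [Finset.sum_comm]
    refine Finset.sum_congr rfl fun i _ => ?_
    rw [Matrix.mul_apply, map_sum, Finset.sum_mul]
    exact Finset.sum_congr rfl fun k _ => by simp [mul_assoc]

theorem linearSubst_one (p : MvPolynomial (Fin r) A) :
    linearSubst (RingHom.id A) 1 p = p := by
  induction p using MvPolynomial.induction_on with
  | C a => simp
  | add p q hp hq => simp only [map_add, hp, hq]
  | mul_X p j hp => rw [map_mul, hp]; simp [Matrix.one_apply]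

end HiggsAlgebra

section HiggsLocalization
open MvPolynomial
attribute [local instance] MvPolynomial.gradedAlgebra MvPolynomial.algebraMvPolynomial
variable {A A' A'' : Type} [CommRing A] [CommRing A'] [CommRing A''] {r : ℕ}

theorem linearSubst_map (ρ : A →+* A') (h : Matrix (Fin r) (Fin r) A')
    (p : MvPolynomial (Fin r) A) :
    linearSubst (RingHom.id A') h (MvPolynomial.map ρ p) = linearSubst ρ h p := by
  induction p using MvPolynomial.induction_on with
  | C a => simp
  | add p q hp hq => simp only [map_add, hp, hq]
  | mul_X p j hp => rw [map_mul, map_mul, map_mul, hp]; simp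

theorem linearSubst_linearSubst_inv (g h : Matrix (Fin r) (Fin r) A) (hg : g * h = 1)
    (q : MvPolynomial (Fin r) A) :
    linearSubst (RingHom.id A) h (linearSubst (RingHom.id A) g q) = q := by
  rw [linearSubst_linearSubst]
  have : g.map (RingHom.id A) = g := by ext; simp
  rw [this, hg, RingHom.id_comp, linearSubst_one]

theorem map_higgsForm (ρ : A →+* A') (Φ : Matrix (Fin r) (Fin r) A) (i j : Fin r) :
    MvPolynomial.map ρ (higgsForm Φ i j) = higgsForm (Φ.map ρ) i j := by
  simp [higgsForm]

theorem map_higgsIdeal (ρ : A →+* A') (Φ : Matrix (Fin r) (Fin r) A) :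
    (higgsIdeal Φ).map (MvPolynomial.map ρ) = higgsIdeal (Φ.map ρ) := by
  rw [higgsIdeal, higgsIdeal, Ideal.map_span]
  congr 1
  ext p
  constructor
  · rintro ⟨_, ⟨i, j, hij, rfl⟩, rfl⟩
    exact ⟨i, j, hij, map_higgsForm ρ Φ i j⟩
  · rintro ⟨i, j, hij, rfl⟩
    exact ⟨_, ⟨i, j, hij, rfl⟩, map_higgsForm ρ Φ i j⟩

theorem isGradedLocalization_higgsMap {Φ : Matrix (Fin r) (Fin r) A}
    {Φ' : Matrix (Fin r) (Fin r) A'} {ρ : A →+* A'} {h : Matrix (Fin r) (Fin r) A'}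
    (H : IsFrameChange Φ Φ' ρ h) (f : A)
    (hf : let _ := ρ.toAlgebra; IsLocalization.Away f A') :
    IsGradedLocalization (higgsMap H) ρ f where
  comm a := by
    change Ideal.Quotient.mk _ (linearSubst ρ h (C a)) = Ideal.Quotient.mk _ (C (ρ a))
    rw [linearSubst_C]
  base := hf
  surj y := by
    obtain ⟨g, hg, hg'⟩ := H.exists_inv
    let _ := ρ.toAlgebra
    have _ := hf
    obtain ⟨q, rfl⟩ := Ideal.Quotient.mk_surjective y
    have hloc : IsLocalization ((Submonoid.powers f).map (C (σ := Fin r)))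
      (MvPolynomial (Fin r) A') := MvPolynomial.isLocalization _ _
    obtain ⟨⟨p, ⟨_, _, ⟨n, rfl⟩, rfl⟩⟩, hp⟩ :=
      IsLocalization.surj ((Submonoid.powers f).map (C (σ := Fin r)))
        (linearSubst (RingHom.id A') g q)
    refine ⟨n, Ideal.Quotient.mk _ p, ?_⟩
    rw [higgsMap_mk]
    change (Ideal.Quotient.mk _ (C (ρ f))) ^ n * _ = _
    rw [← map_pow, ← map_mul]
    congr 1
    change _ * MvPolynomial.map ρ (C (f ^ n)) = MvPolynomial.map ρ p at hp
    rw [← linearSubst_map, ← hp, map_mul, linearSubst_linearSubst_inv g h hg']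
    simp [mul_comm]
  inj x hx := by
    obtain ⟨g, hg, hg'⟩ := H.exists_inv
    obtain ⟨u, ⟨u, rfl⟩, hu⟩ := H.conj
    let _ := ρ.toAlgebra
    have _ := hf
    obtain ⟨p, rfl⟩ := Ideal.Quotient.mk_surjective x
    have hloc : IsLocalization ((Submonoid.powers f).map (C (σ := Fin r)))
      (MvPolynomial (Fin r) A') := MvPolynomial.isLocalization _ _
    rw [higgsMap_mk, Ideal.Quotient.eq_zero_iff_mem] at hx
    have hinv : IsFrameChange Φ' (Φ.map ρ) (RingHom.id A') g := by
      refine ⟨⟨h, hg', hg⟩, (u⁻¹ : A'ˣ), Units.isUnit _, ?_⟩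
      have e0 : Φ'.map (RingHom.id A') = Φ' := by ext; simp
      have e1 : Φ' = (u : A') • (g * (Φ.map ρ * h)) := by
        rw [← Matrix.mul_smul, ← hu, ← Matrix.mul_assoc, hg', Matrix.one_mul]
      rw [e0, e1, Matrix.smul_mul, smul_smul, Units.inv_mul, one_smul, Matrix.mul_assoc,
        Matrix.mul_assoc, hg, Matrix.mul_one]
    have h1 := linearSubst_mem _ _ _ _ hinv hx
    rw [Ideal.mem_comap, ← linearSubst_map ρ h p, linearSubst_linearSubst_inv h g hg,
      ← map_higgsIdeal] at h1
    change algebraMap _ (MvPolynomial (Fin r) A') p ∈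
      (higgsIdeal Φ).map (algebraMap (MvPolynomial (Fin r) A) (MvPolynomial (Fin r) A')) at h1
    rw [IsLocalization.algebraMap_mem_map_algebraMap_iff
      ((Submonoid.powers f).map (C (σ := Fin r)))] at h1
    obtain ⟨_, ⟨_, ⟨n, rfl⟩, rfl⟩, h2⟩ := h1
    refine ⟨n, ?_⟩
    change (Ideal.Quotient.mk _ (C f)) ^ n * _ = _
    rw [← map_pow, ← map_mul, Ideal.Quotient.eq_zero_iff_mem, ← map_pow]
    exact h2

end HiggsLocalization

section Forms
open KaehlerDifferential TensorProduct
variable {A A' A'' : Type} [CommRing A] [CommRing A'] [CommRing A'']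
  [Algebra ℂ A] [Algebra ℂ A'] [Algebra ℂ A'']

/-- The additive map on Kähler differentials induced by a homomorphism of algebras. -/
noncomputable def formMap (ρ : A →ₐ[ℂ] A') : Ω[A⁄ℂ] →+ Ω[A'⁄ℂ] :=
  letI := ρ.toRingHom.toAlgebra
  haveI : IsScalarTower ℂ A A' := .of_algebraMap_eq fun z => (ρ.commutes z).symm
  (KaehlerDifferential.map ℂ ℂ A A').toAddMonoidHom

theorem formMap_smul (ρ : A →ₐ[ℂ] A') (a : A) (ω : Ω[A⁄ℂ]) :
    formMap ρ (a • ω) = ρ a • formMap ρ ω := by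
  let _ := ρ.toRingHom.toAlgebra
  have _ : IsScalarTower ℂ A A' := .of_algebraMap_eq fun z => (ρ.commutes z).symm
  refine ((KaehlerDifferential.map ℂ ℂ A A').map_smul a ω).trans ?_
  exact (algebraMap_smul A' a _).symm

/-- `ω` freely generates the module of Kähler differentials. -/
def IsCoframe (ω : Ω[A⁄ℂ]) : Prop := Function.Bijective fun a : A => a • ω

/-- The basis consisting of a free generator of the module of Kähler differentials. -/
noncomputable def IsCoframe.basis {ω : Ω[A⁄ℂ]} (hω : IsCoframe ω) : Module.Basis Unit A Ω[A⁄ℂ] :=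
  (Module.Basis.singleton Unit A).map (LinearEquiv.ofBijective (LinearMap.toSpanSingleton A _ ω) hω)

theorem IsCoframe.basis_apply {ω : Ω[A⁄ℂ]} (hω : IsCoframe ω) : hω.basis () = ω := by
  rw [IsCoframe.basis, Module.Basis.map_apply, Module.Basis.singleton_apply]
  exact one_smul A ω

theorem isCoframe_basis (b : Module.Basis Unit A Ω[A⁄ℂ]) : IsCoframe (b ()) := by
  have : (fun a : A => a • b ()) =
      ((Module.Basis.singleton Unit A).equiv b (Equiv.refl Unit)) := by
    ext a
    have := ((Module.Basis.singleton Unit A).equiv b (Equiv.refl Unit)).map_smul a 1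
    rw [smul_eq_mul, mul_one] at this
    rw [this]
    congr 1
    simpa using ((Module.Basis.singleton Unit A).equiv_apply () b (Equiv.refl Unit)).symm
  rw [IsCoframe, this]
  exact LinearEquiv.bijective _

theorem isCoframe_formMap (ρ : A →ₐ[ℂ] A') (f : A)
    (hf : letI := ρ.toRingHom.toAlgebra; IsLocalization.Away f A') {ω : Ω[A⁄ℂ]}
    (hω : IsCoframe ω) : IsCoframe (formMap ρ ω) := by
  let _ := ρ.toRingHom.toAlgebra
  have _ : IsScalarTower ℂ A A' := .of_algebraMap_eq fun z => (ρ.commutes z).symm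
  have _ := hf
  have hloc := KaehlerDifferential.isLocalizedModule_map (R := ℂ) (S := A) (T := A')
    (Submonoid.powers f)
  let b' := hω.basis.ofIsLocalizedModule A' (Submonoid.powers f)
    (KaehlerDifferential.map ℂ ℂ A A')
  have hb' : b' () = formMap ρ ω := by
    rw [Module.Basis.ofIsLocalizedModule_apply, hω.basis_apply]; rfl
  rw [← hb']
  exact isCoframe_basis b'

theorem exists_unit_of_isCoframe {ω ω' : Ω[A⁄ℂ]} (hω : IsCoframe ω) (hω' : IsCoframe ω') :
    ∃ u : A, IsUnit u ∧ ω = u • ω' := by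
  obtain ⟨u, hu⟩ := hω'.2 ω
  obtain ⟨v, hv⟩ := hω.2 ω'
  refine ⟨u, .of_mul_eq_one v (hω'.1 ?_), hu.symm⟩
  simp only at hu hv ⊢
  rw [one_smul, mul_comm, mul_smul, hu, hv]

variable {M M' : Type} [AddCommGroup M] [Module A M] [AddCommGroup M'] [Module A' M'] {r : ℕ}

/-- The additive map `M ⊗ Ω[A⁄ℂ] → M' ⊗ Ω[A'⁄ℂ]` induced by a semilinear map `M → M'`. -/
noncomputable def tensorFormMap (ρ : A →ₐ[ℂ] A') (μ : M →+ M')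
    (hμ : ∀ (a : A) (m : M), μ (a • m) = ρ a • μ m) :
    M ⊗[A] Ω[A⁄ℂ] →+ M' ⊗[A'] Ω[A'⁄ℂ] :=
  TensorProduct.liftAddHom
    { toFun := fun m =>
        ((TensorProduct.mk A' M' Ω[A'⁄ℂ] (μ m)).toAddMonoidHom).comp (formMap ρ)
      map_zero' := by ext; simp
      map_add' := fun m n => by ext; simp }
    fun a m ω => by
      change μ (a • m) ⊗ₜ[A'] formMap ρ ω = μ m ⊗ₜ[A'] formMap ρ (a • ω)
      rw [hμ, formMap_smul, TensorProduct.smul_tmul]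

theorem tensorFormMap_tmul (ρ : A →ₐ[ℂ] A') (μ : M →+ M')
    (hμ : ∀ (a : A) (m : M), μ (a • m) = ρ a • μ m) (m : M) (ω : Ω[A⁄ℂ]) :
    tensorFormMap ρ μ hμ (m ⊗ₜ ω) = μ m ⊗ₜ formMap ρ ω := rfl

/-- The matrix `Φ` of a map `φ : M → M ⊗ Ω` in a basis `b` of `M` and with respect to a free
generator `ω` of `Ω`, determined by `φ (b j) = ∑ᵢ Φ i j • (b i ⊗ ω)`. -/
noncomputable def higgsMatrix (φ : M →ₗ[A] M ⊗[A] Ω[A⁄ℂ]) (b : Module.Basis (Fin r) A M)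
    {ω : Ω[A⁄ℂ]} (hω : IsCoframe ω) : Matrix (Fin r) (Fin r) A :=
  fun i j => (b.tensorProduct hω.basis).repr (φ (b j)) (i, ())

theorem higgsMatrix_spec (φ : M →ₗ[A] M ⊗[A] Ω[A⁄ℂ]) (b : Module.Basis (Fin r) A M)
    {ω : Ω[A⁄ℂ]} (hω : IsCoframe ω) (j : Fin r) :
    φ (b j) = ∑ i, higgsMatrix φ b hω i j • (b i ⊗ₜ[A] ω) := by
  conv_lhs => rw [← (b.tensorProduct hω.basis).sum_repr (φ (b j))]
  rw [Fintype.sum_prod_type]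
  refine Finset.sum_congr rfl fun i _ => ?_
  simp [higgsMatrix, Module.Basis.tensorProduct_apply, hω.basis_apply]

theorem coeff_eq_of_sum_eq (b : Module.Basis (Fin r) A M) {ω : Ω[A⁄ℂ]} (hω : IsCoframe ω)
    (x y : Fin r → A) (h : ∑ i, x i • (b i ⊗ₜ[A] ω) = ∑ i, y i • (b i ⊗ₜ[A] ω)) : x = y := by
  have key : ∀ (x : Fin r → A) (i : Fin r),
      (b.tensorProduct hω.basis).repr (∑ i, x i • (b i ⊗ₜ[A] ω)) (i, ()) = x i := by
    intro x i
    have : ∀ k, b k ⊗ₜ[A] ω = b.tensorProduct hω.basis (k, ()) := fun k => by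
      rw [Module.Basis.tensorProduct_apply, hω.basis_apply]
    simp [this, Finsupp.single_apply]
  ext i
  rw [← key x i, h, key]

theorem isFrameChange_higgsMatrix (ρ : A →ₐ[ℂ] A') (μ : M →+ M')
    (hμ : ∀ (a : A) (m : M), μ (a • m) = ρ a • μ m)
    (φ : M →ₗ[A] M ⊗[A] Ω[A⁄ℂ]) (φ' : M' →ₗ[A'] M' ⊗[A'] Ω[A'⁄ℂ])
    (hφ : ∀ m, φ' (μ m) = tensorFormMap ρ μ hμ (φ m))
    (b : Module.Basis (Fin r) A M) (c b' : Module.Basis (Fin r) A' M') (hc : ∀ i, c i = μ (b i))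
    {ω : Ω[A⁄ℂ]} {ω' : Ω[A'⁄ℂ]} (hω : IsCoframe ω) (hω' : IsCoframe ω')
    (hρω : IsCoframe (formMap ρ ω)) :
    IsFrameChange (higgsMatrix φ b hω) (higgsMatrix φ' b' hω') ρ.toRingHom (c.toMatrix b') := by
  refine ⟨⟨b'.toMatrix c, c.toMatrix_mul_toMatrix_flip b', b'.toMatrix_mul_toMatrix_flip c⟩, ?_⟩
  obtain ⟨u, hu, hω2⟩ := exists_unit_of_isCoframe hρω hω'
  refine ⟨u, hu, ?_⟩
  have hb' : ∀ j, b' j = ∑ i, c.toMatrix b' i j • c i := fun j => by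
    simp [Module.Basis.toMatrix_apply]
  have h1 : ∀ j, φ' (b' j) = ∑ k, (c.toMatrix b' * higgsMatrix φ' b' hω') k j • (c k ⊗ₜ[A'] ω') := by
    intro j
    rw [higgsMatrix_spec φ' b' hω' j]
    simp only [Matrix.mul_apply, Finset.sum_smul]
    rw [Finset.sum_comm]
    refine Finset.sum_congr rfl fun i _ => ?_
    rw [hb' i, TensorProduct.sum_tmul, Finset.smul_sum]
    refine Finset.sum_congr rfl fun k _ => ?_
    rw [mul_comm, mul_smul]
    simp only [TensorProduct.smul_tmul']
  have h2 : ∀ j, φ' (b' j) =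
      ∑ k, (u • ((higgsMatrix φ b hω).map ρ.toRingHom * c.toMatrix b')) k j •
        (c k ⊗ₜ[A'] ω') := by
    intro j
    rw [hb' j, map_sum]
    simp only [Matrix.smul_apply, Matrix.mul_apply, Finset.smul_sum, Finset.sum_smul]
    rw [Finset.sum_comm]
    refine Finset.sum_congr rfl fun i _ => ?_
    rw [map_smul, hc, hφ, higgsMatrix_spec φ b hω i, map_sum, Finset.smul_sum]
    refine Finset.sum_congr rfl fun k _ => ?_
    rw [← TensorProduct.tmul_smul, tensorFormMap_tmul, formMap_smul, hω2, hc,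
      TensorProduct.tmul_smul, TensorProduct.tmul_smul, smul_smul, smul_smul]
    congr 1
    simp only [Matrix.map_apply, AlgHom.toRingHom_eq_coe, RingHom.coe_coe, smul_eq_mul]
    ring
  ext k j
  exact congrFun (coeff_eq_of_sum_eq c hω' _ _ ((h1 j).symm.trans (h2 j))) k

end Forms

section HiggsBundles
open KaehlerDifferential TensorProduct TopologicalSpace

variable {B : Scheme.{0}}

/-- The restriction of sections of a sheaf of modules. -/
noncomputable def resSec (E : B.Modules) {V' V : B.Opens} (h : V' ≤ V) : Γ(E, V) →+ Γ(E, V') :=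
  (E.presheaf.map (homOfLE h).op).hom

theorem resSec_resSec (E : B.Modules) {V V' V'' : B.Opens} (h : V' ≤ V) (h' : V'' ≤ V')
    (m : Γ(E, V)) : resSec E h' (resSec E h m) = resSec E (h'.trans h) m := by
  change (E.presheaf.map (homOfLE h).op ≫ E.presheaf.map (homOfLE h').op).hom m = _
  rw [← E.presheaf.map_comp]
  rfl

theorem resSec_self (E : B.Modules) {V : B.Opens} (h : V ≤ V) (m : Γ(E, V)) :
    resSec E h m = m := by
  change E.presheaf.map (𝟙 _) m = m
  rw [E.presheaf.map_id]
  rfl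

/-- The sections `e₁, …, eᵣ` over `V` form a frame: they freely generate `E` over `V`. -/
def IsFrame (E : B.Modules) {V : B.Opens} {r : ℕ} (e : Fin r → Γ(E, V)) : Prop :=
  ∀ (V' : B.Opens) (h : V' ≤ V), LinearIndependent Γ(B, V') (fun i => resSec E h (e i)) ∧
    ⊤ ≤ Submodule.span Γ(B, V') (Set.range fun i => resSec E h (e i))

theorem IsFrame.res {E : B.Modules} {V V' : B.Opens} {r : ℕ} {e : Fin r → Γ(E, V)}
    (he : IsFrame E e) (h : V' ≤ V) : IsFrame E fun i => resSec E h (e i) := by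
  intro V'' h'
  simp only [resSec_resSec]
  exact he V'' (h'.trans h)

/-- The basis of the module of sections over a smaller open subset given by a frame. -/
noncomputable def IsFrame.basis {E : B.Modules} {V : B.Opens} {r : ℕ} {e : Fin r → Γ(E, V)}
    (he : IsFrame E e) {V' : B.Opens} (h : V' ≤ V) : Module.Basis (Fin r) Γ(B, V') Γ(E, V') :=
  .mk (he V' h).1 (he V' h).2

theorem IsFrame.basis_apply {E : B.Modules} {V : B.Opens} {r : ℕ} {e : Fin r → Γ(E, V)}
    (he : IsFrame E e) {V' : B.Opens} (h : V' ≤ V) (i : Fin r) :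
    he.basis h i = resSec E h (e i) := by
  rw [IsFrame.basis, Module.Basis.mk_apply]

variable [B.Over (Spec (.of ℂ))]

/-- The `ℂ`-algebra structure on the sections of the structure sheaf of a scheme over `ℂ`. -/
noncomputable instance sectionsAlgebra (V : B.Opens) : Algebra ℂ Γ(B, V) :=
  ((Scheme.ΓSpecIso (.of ℂ)).inv ≫
    (B ↘ Spec (.of ℂ)).appLE ⊤ V (by simp)).hom.toAlgebra

/-- The restriction of functions, as a homomorphism of `ℂ`-algebras. -/
noncomputable def resFun {V' V : B.Opens} (h : V' ≤ V) : Γ(B, V) →ₐ[ℂ] Γ(B, V') where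
  toRingHom := (B.presheaf.map (homOfLE h).op).hom
  commutes' z := by
    change (B.presheaf.map (homOfLE h).op).hom (((Scheme.ΓSpecIso (.of ℂ)).inv ≫
      (B ↘ Spec (.of ℂ)).appLE ⊤ V (by simp)).hom z) = ((Scheme.ΓSpecIso (.of ℂ)).inv ≫
      (B ↘ Spec (.of ℂ)).appLE ⊤ V' (by simp)).hom z
    rw [← Scheme.Hom.appLE_map (B ↘ Spec (.of ℂ)) (U := ⊤) (by simp) (homOfLE h).op]
    rfl

theorem resSec_smul (E : B.Modules) {V' V : B.Opens} (h : V' ≤ V) (a : Γ(B, V)) (m : Γ(E, V)) :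
    resSec E h (a • m) = resFun h a • resSec E h m :=
  E.map_smul (homOfLE h) a m

theorem resFun_resFun {V V' V'' : B.Opens} (h : V' ≤ V) (h' : V'' ≤ V') (a : Γ(B, V)) :
    resFun h' (resFun h a) = resFun (h'.trans h) a := by
  change (B.presheaf.map (homOfLE h).op ≫ B.presheaf.map (homOfLE h').op).hom a = _
  rw [← B.presheaf.map_comp]
  rfl

variable (B) in
/-- A Higgs bundle of rank `r` on `B`: a locally free sheaf `E` of rank `r` with an
`𝒪`-linear morphism `φ : E → E ⊗ Ω¹`, given by its values on the affine open subsets.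
The integrability condition `φ ∧ φ = 0` is void on a curve. -/
structure HiggsBundle (r : ℕ) where
  E : B.Modules
  locallyFree : ∀ x : B, ∃ W : B.Opens, x ∈ W ∧ ∃ e : Fin r → Γ(E, W), IsFrame E e
  φ : ∀ V : B.affineOpens, Γ(E, V.1) →ₗ[Γ(B, V.1)] Γ(E, V.1) ⊗[Γ(B, V.1)] Ω[Γ(B, V.1)⁄ℂ]
  φ_res : ∀ (V V' : B.affineOpens) (h : V'.1 ≤ V.1) (m : Γ(E, V.1)),
    φ V' (resSec E h m) = tensorFormMap (resFun h) (resSec E h) (resSec_smul E h) (φ V m)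


theorem resFun_self {V : B.Opens} (h : V ≤ V) (a : Γ(B, V)) : resFun h a = a := by
  change (B.presheaf.map (𝟙 _)).hom a = a
  rw [B.presheaf.map_id]
  rfl

/-- A local trivialization of a Higgs bundle on a curve: an affine open subset, a frame of the
bundle, and a generator of the sheaf of differentials. -/
structure HiggsBundle.Trivialization {r : ℕ} (𝔈 : HiggsBundle B r) where
  V : B.AffineZariskiSite
  e : Fin r → Γ(𝔈.E, V.toOpens)
  isFrame : IsFrame 𝔈.E e
  ω : Ω[Γ(B, V.toOpens)⁄ℂ]
  isCoframe : IsCoframe ω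

namespace HiggsBundle.Trivialization

variable {r : ℕ} {𝔈 : HiggsBundle B r}

instance : Preorder 𝔈.Trivialization := Preorder.lift Trivialization.V

theorem le_opens {t' t : 𝔈.Trivialization} (h : t' ≤ t) : t'.V.toOpens ≤ t.V.toOpens :=
  Scheme.AffineZariskiSite.toOpens_mono h

/-- The matrix of the Higgs field: `φ (e j) = ∑ᵢ Φ i j • (e i ⊗ ω)`. -/
noncomputable def matrix (t : 𝔈.Trivialization) : Matrix (Fin r) (Fin r) Γ(B, t.V.toOpens) :=
  higgsMatrix (𝔈.φ ⟨t.V.toOpens, t.V.2⟩) (t.isFrame.basis le_rfl) t.isCoframe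

/-- The matrix expressing a frame through the restriction of another one. -/
noncomputable def transition {t' t : 𝔈.Trivialization} (h : t' ≤ t) :
    Matrix (Fin r) (Fin r) Γ(B, t'.V.toOpens) :=
  (t.isFrame.basis (le_opens h)).toMatrix (t'.isFrame.basis le_rfl)

theorem isLocalization_res {t' t : 𝔈.Trivialization} (h : t' ≤ t) :
    ∃ f : Γ(B, t.V.toOpens),
      letI := (resFun (B := B) (le_opens h)).toRingHom.toAlgebra
      IsLocalization.Away f Γ(B, t'.V.toOpens) := by
  obtain ⟨⟨V, hV⟩, e, he, ω, hω⟩ := t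
  obtain ⟨⟨V', hV'⟩, e', he', ω', hω'⟩ := t'
  obtain ⟨f, hf⟩ : ∃ f : Γ(B, V), B.basicOpen f = V' := h
  subst hf
  exact ⟨f, hV.isLocalization_basicOpen f⟩

theorem isFrameChange {t' t : 𝔈.Trivialization} (h : t' ≤ t) :
    IsFrameChange t.matrix t'.matrix (resFun (le_opens h)).toRingHom (transition h) := by
  obtain ⟨f, hf⟩ := isLocalization_res h
  refine isFrameChange_higgsMatrix _ (resSec 𝔈.E (le_opens h)) (resSec_smul 𝔈.E (le_opens h))
    _ _ (𝔈.φ_res ⟨t.V.toOpens, t.V.2⟩ ⟨t'.V.toOpens, t'.V.2⟩ (le_opens h)) _ _ _ (fun i => ?_)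
    t.isCoframe t'.isCoframe (isCoframe_formMap _ f hf t.isCoframe)
  rw [IsFrame.basis_apply, IsFrame.basis_apply, resSec_self]

theorem transition_self (t : 𝔈.Trivialization) : transition (le_refl t) = 1 :=
  Module.Basis.toMatrix_self _

theorem transition_comp {t'' t' t : 𝔈.Trivialization} (h' : t'' ≤ t') (h : t' ≤ t) :
    transition (h'.trans h) =
      (transition h).map (resFun (B := B) (le_opens h')).toRingHom * transition h' := by
  have key : (transition h).map (resFun (B := B) (le_opens h')).toRingHom =
      (t.isFrame.basis (le_opens (h'.trans h))).toMatrix (t'.isFrame.basis (le_opens h')) := by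
    ext i j
    have h1 : t'.isFrame.basis (le_opens h') j = ∑ i, (resFun (B := B) (le_opens h'))
        (transition h i j) • t.isFrame.basis (le_opens (h'.trans h)) i := by
      have h2 := (t.isFrame.basis (le_opens h)).sum_repr (t'.isFrame.basis le_rfl j)
      replace h2 := congrArg (resSec 𝔈.E (le_opens h')) h2
      rw [map_sum, IsFrame.basis_apply, resSec_self] at h2
      rw [IsFrame.basis_apply, ← h2]
      refine Finset.sum_congr rfl fun i _ => ?_
      rw [resSec_smul, IsFrame.basis_apply, IsFrame.basis_apply, resSec_resSec, transition,
        Module.Basis.toMatrix_apply, IsFrame.basis_apply, resSec_self]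
    rw [Module.Basis.toMatrix_apply, h1, map_sum, Finsupp.finsetSum_apply]
    simp [Finsupp.single_apply]
  rw [key]
  exact (Module.Basis.toMatrix_mul_toMatrix _ _ _).symm

/-- The inclusion of the local models of the rank one Higgs Grassmannian. -/
noncomputable def gradedMap {t' t : 𝔈.Trivialization} (h : t' ≤ t) :
    higgsGrading t.matrix →+*ᵍ higgsGrading t'.matrix :=
  higgsMap (isFrameChange h)

theorem exists_isGradedLocalization {t' t : 𝔈.Trivialization} (h : t' ≤ t) :
    ∃ f, IsGradedLocalization (gradedMap h) (resFun (B := B) (le_opens h)).toRingHom f := by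
  obtain ⟨f, hf⟩ := isLocalization_res h
  exact ⟨f, isGradedLocalization_higgsMap (isFrameChange h) f hf⟩

theorem irrelevant_le {t' t : 𝔈.Trivialization} (h : t' ≤ t) :
    HomogeneousIdeal.irrelevant (higgsGrading t'.matrix) ≤
      (HomogeneousIdeal.irrelevant (higgsGrading t.matrix)).map (gradedMap h) :=
  (exists_isGradedLocalization h).choose_spec.irrelevant_le

theorem gradedMap_self (t : 𝔈.Trivialization) :
    gradedMap (le_refl t) = GradedRingHom.id (higgsGrading t.matrix) := by
  refine GradedRingHom.ext fun x => ?_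
  obtain ⟨p, rfl⟩ := Ideal.Quotient.mk_surjective x
  refine (higgsMap_mk _ p).trans ?_
  have : (resFun (B := B) (le_opens (le_refl t))).toRingHom = RingHom.id _ :=
    RingHom.ext fun a => resFun_self _ a
  rw [transition_self, this, linearSubst_one]
  rfl

theorem gradedMap_comp {t'' t' t : 𝔈.Trivialization} (h' : t'' ≤ t') (h : t' ≤ t) :
    gradedMap (h'.trans h) = (gradedMap h').comp (gradedMap h) := by
  refine GradedRingHom.ext fun x => ?_
  obtain ⟨p, rfl⟩ := Ideal.Quotient.mk_surjective x
  refine (higgsMap_mk _ p).trans ?_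
  refine Eq.trans ?_ (congrArg (higgsMap (isFrameChange h'))
    (higgsMap_mk (isFrameChange h) p)).symm
  rw [higgsMap_mk, linearSubst_linearSubst, transition_comp h' h]
  congr 3
  exact RingHom.ext fun a => (resFun_resFun _ _ a).symm

variable (𝔈) in
/-- The local models `Proj A[z₁, …, zᵣ] / (∑ₖ zₖ (Φⱼₖ zᵢ - Φᵢₖ zⱼ))` of the rank one Higgs
Grassmannian. -/
noncomputable def functor : 𝔈.Trivialization ⥤ Scheme.{0} where
  obj t := Proj (higgsGrading t.matrix)
  map h := Proj.map (gradedMap h.le) (irrelevant_le h.le)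
  map_id t := by
    simp only [gradedMap_self]
    exact Proj.map_id
  map_comp h' h := by
    simp only [gradedMap_comp h'.le h.le]
    exact Proj.map_comp _ _ _ _

end HiggsBundle.Trivialization

end HiggsBundles

section HiggsGrassmannian
open KaehlerDifferential TensorProduct TopologicalSpace Limits

variable {B : Scheme.{0}}

theorem homOfLE_self (V : B.Opens) (h : V ≤ V) : B.homOfLE h = 𝟙 _ := by
  rw [← cancel_mono V.ι, Scheme.homOfLE_ι, Category.id_comp]

variable [B.Over (Spec (.of ℂ))]

theorem exists_isCoframe [SmoothOfRelativeDimension 1 (B ↘ Spec (.of ℂ))] (x : B) :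
    ∃ V : B.Opens, IsAffineOpen V ∧ x ∈ V ∧ ∃ ω : Ω[Γ(B, V)⁄ℂ], IsCoframe ω := by
  obtain ⟨U, -, V, hV, hx, e, H⟩ :=
    SmoothOfRelativeDimension.exists_isStandardSmoothOfRelativeDimension
      (n := 1) (f := B ↘ Spec (.of ℂ)) x
  obtain rfl : U = ⊤ := by
    have hp : (B ↘ Spec (.of ℂ)) x ∈ U := e hx
    refine top_unique fun y _ => ?_
    have : Subsingleton (PrimeSpectrum ℂ) := inferInstance
    have : y = (B ↘ Spec (.of ℂ)) x := Subsingleton.elim (α := PrimeSpectrum ℂ) _ _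
    rwa [this]
  refine ⟨V, hV, hx, ?_⟩
  have h1 : RingHom.IsStandardSmoothOfRelativeDimension 1 (algebraMap ℂ Γ(B, V)) := by
    have h0 := RingHom.IsStandardSmoothOfRelativeDimension.comp H
      (RingHom.IsStandardSmoothOfRelativeDimension.equiv
        (Scheme.ΓSpecIso (.of ℂ)).symm.commRingCatIsoToRingEquiv)
    exact h0
  have h2 : Algebra.IsStandardSmoothOfRelativeDimension 1 ℂ Γ(B, V) :=
    (RingHom.isStandardSmoothOfRelativeDimension_algebraMap 1).mp h1
  have _ : Nonempty V := ⟨⟨x, hx⟩⟩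
  have h3 : Nontrivial Γ(B, V) := inferInstance
  have h4 := Algebra.IsStandardSmoothOfRelativeDimension.rank_kaehlerDifferential
    (R := ℂ) (S := Γ(B, V)) 1
  have h5 : Algebra.IsStandardSmooth ℂ Γ(B, V) := h2.isStandardSmooth
  have h6 : Module.Free Γ(B, V) Ω[Γ(B, V)⁄ℂ] := inferInstance
  have b := Module.basisUnique Unit (Module.rank_eq_one_iff_finrank_eq_one.mp (by exact_mod_cast h4))
  exact ⟨_, isCoframe_basis b⟩

namespace HiggsBundle

variable {r : ℕ} (𝔈 : HiggsBundle B r)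

theorem exists_trivialization [SmoothOfRelativeDimension 1 (B ↘ Spec (.of ℂ))] (x : B) :
    ∃ t : 𝔈.Trivialization, x ∈ t.V.toOpens := by
  obtain ⟨V, hV, hxV, ω, hω⟩ := exists_isCoframe x
  obtain ⟨W, hxW, e, he⟩ := 𝔈.locallyFree x
  obtain ⟨f, hfW, hxf⟩ := hV.exists_basicOpen_le ⟨x, hxW⟩ hxV
  refine ⟨⟨⟨B.basicOpen f, hV.basicOpen f⟩, _, he.res hfW,
    formMap (resFun (B.basicOpen_le f)) ω, isCoframe_formMap _ f ?_ hω⟩, hxf⟩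
  exact hV.isLocalization_basicOpen f

theorem isPullback_isoSpec {t' t : 𝔈.Trivialization} (h : t' ≤ t) :
    IsPullback (Spec.map (CommRingCat.ofHom
      (resFun (B := B) (Trivialization.le_opens h)).toRingHom)) t'.V.2.isoSpec.inv
      t.V.2.isoSpec.inv (B.homOfLE (Trivialization.le_opens h)) := by
  refine IsPullback.of_vert_isIso ⟨?_⟩
  rw [Iso.comp_inv_eq, Category.assoc, Iso.eq_inv_comp]
  rw [IsAffineOpen.isoSpec_hom, IsAffineOpen.isoSpec_hom]
  exact Scheme.Opens.toSpecΓ_SpecMap_presheaf_map _ _ (Trivialization.le_opens h)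

theorem isPullback_gluing {t' t : 𝔈.Trivialization} (h : t' ≤ t) :
    IsPullback ((Trivialization.functor 𝔈).map (homOfLE h))
      (projToSpec (higgsGrading t'.matrix) ≫ t'.V.2.isoSpec.inv)
      (projToSpec (higgsGrading t.matrix) ≫ t.V.2.isoSpec.inv)
      (B.homOfLE (Trivialization.le_opens h)) :=
  (Trivialization.exists_isGradedLocalization h).choose_spec.isPullback_proj.paste_vert
    (𝔈.isPullback_isoSpec h)

theorem exists_lift_eq (t u : 𝔈.Trivialization)
    (x : (pullback t.V.toOpens.ι u.V.toOpens.ι).carrier) :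
    ∃ (k : 𝔈.Trivialization) (hkt : k ⟶ t) (hku : k ⟶ u) (y : (k.V.toOpens : Scheme.{0})),
      pullback.lift (B.homOfLE (Trivialization.le_opens hkt.le))
        (B.homOfLE (Trivialization.le_opens hku.le)) (by simp) y = x := by
  let a : B := (pullback.fst t.V.toOpens.ι u.V.toOpens.ι ≫ t.V.toOpens.ι) x
  have ha : a ∈ t.V.toOpens := (pullback.fst t.V.toOpens.ι u.V.toOpens.ι x).2
  have ha' : a ∈ u.V.toOpens := by
    unfold a
    rw [pullback.condition]
    exact (pullback.snd t.V.toOpens.ι u.V.toOpens.ι x).2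
  obtain ⟨f, g, hfg, hxf⟩ := exists_basicOpen_le_affine_inter t.V.2 u.V.2 a ⟨ha, ha'⟩
  let k : 𝔈.Trivialization := ⟨t.V.basicOpen f, _, t.isFrame.res (B.basicOpen_le f),
    formMap (resFun (B.basicOpen_le f)) t.ω,
    isCoframe_formMap _ f (t.V.2.isLocalization_basicOpen f) t.isCoframe⟩
  have hkt : k ≤ t := ⟨f, rfl⟩
  have hku : k ≤ u := ⟨g, hfg.symm⟩
  have hxk : a ∈ k.V.toOpens := hxf
  clear_value k
  obtain ⟨y, hy⟩ : ∃ y : (k.V.toOpens : Scheme.{0}), k.V.toOpens.ι y = a := ⟨⟨a, hxk⟩, rfl⟩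
  refine ⟨k, homOfLE hkt, homOfLE hku, y, ?_⟩
  apply (pullback.fst t.V.toOpens.ι u.V.toOpens.ι ≫ t.V.toOpens.ι).isOpenEmbedding.injective
  rw [← Scheme.Hom.comp_apply, pullback.lift_fst_assoc, Scheme.homOfLE_ι, hy]

variable [SmoothOfRelativeDimension 1 (B ↘ Spec (.of ℂ))]

/-- The open cover of a smooth curve by the local trivializations of a Higgs bundle. -/
noncomputable def trivializationCover : B.OpenCover where
  I₀ := 𝔈.Trivialization
  X t := t.V.toOpens
  f t := t.V.toOpens.ι
  mem₀ := by
    rw [Scheme.presieve₀_mem_precoverage_iff]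
    refine ⟨fun x => ?_, inferInstance⟩
    obtain ⟨t, hx⟩ := 𝔈.exists_trivialization x
    exact ⟨t, ⟨x, hx⟩, rfl⟩

noncomputable instance : Preorder 𝔈.trivializationCover.I₀ :=
  inferInstanceAs (Preorder 𝔈.Trivialization)

noncomputable instance : 𝔈.trivializationCover.LocallyDirected where
  trans h := B.homOfLE (Trivialization.le_opens h.le)
  trans_id _ := homOfLE_self _ _
  trans_comp _ _ := (B.homOfLE_homOfLE _ _).symm
  w _ := B.homOfLE_ι _
  directed {t u} x := 𝔈.exists_lift_eq t u x
  property_trans _ := inferInstanceAs (IsOpenImmersion (B.homOfLE _))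

/-- The data for gluing the local models of the rank one Higgs Grassmannian. -/
noncomputable def gluingData : 𝔈.trivializationCover.RelativeGluingData where
  functor := Trivialization.functor 𝔈
  natTrans :=
    { app := fun t => projToSpec (higgsGrading t.matrix) ≫ t.V.2.isoSpec.inv
      naturality := fun _ _ h => (𝔈.isPullback_gluing h.le).w }
  equifibered _ _ h := 𝔈.isPullback_gluing h.le

/-- The Higgs Grassmannian of rank one Higgs subbundles of a Higgs bundle on a smooth curve: the
closed subscheme of `ℙ(E)` (where `ℙ(E)` parametrizes the lines `z₁ e₁ + ⋯ + zᵣ eᵣ` in `E`) of the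
`φ`-invariant lines. It is glued from its parts over the domains of the local trivializations,
where it is the closed subscheme of `ℙ(E) = Proj A[z₁, …, zᵣ]` with the equations
`∑ₖ zₖ (Φⱼₖ zᵢ - Φᵢₖ zⱼ) = 0`. -/
noncomputable def hgrass : Scheme.{0} := 𝔈.gluingData.glued

/-- The projection of the rank one Higgs Grassmannian. -/
noncomputable def hgrassProj : 𝔈.hgrass ⟶ B := 𝔈.gluingData.toBase

/-- Over the domain of a local trivialization, the Higgs Grassmannian is the local model. -/
theorem isPullback_chart (t : 𝔈.Trivialization) :
    IsPullback (projToSpec (higgsGrading t.matrix) ≫ t.V.2.isoSpec.inv)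
      (colimit.ι 𝔈.gluingData.functor t) t.V.toOpens.ι 𝔈.hgrassProj :=
  𝔈.gluingData.isPullback_natTrans_ι_toBase t

end HiggsBundle
end HiggsGrassmannian

section JordanTypes
open KaehlerDifferential TensorProduct

/-- The combinatorial data of a Jordan type: eigenvalues numbered by `v`, the different sizes
`i_{vj}` of the Jordan blocks with eigenvalue number `v`, and their multiplicities `m_{vj}`. -/
structure JordanType where
  s : ℕ
  numSizes : Fin s → ℕ
  numSizes_pos : ∀ v, 0 < numSizes v
  size : ∀ v, Fin (numSizes v) → ℕ
  size_pos : ∀ v j, 0 < size v j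
  size_injective : ∀ v, Function.Injective (size v)
  mult : ∀ v, Fin (numSizes v) → ℕ
  mult_pos : ∀ v j, 0 < mult v j

/-- The Jordan blocks, each occurring as often as its multiplicity says. -/
abbrev JordanType.Block (T : JordanType) : Type := Σ (v : Fin T.s) (j : Fin (T.numSizes v)),
  Fin (T.mult v j)

/-- The size of a Jordan block. -/
def JordanType.blockSize (T : JordanType) (b : T.Block) : ℕ := T.size b.1 b.2.1

/-- The Jordan block of size `n` with eigenvalue `c`. -/
def jordanBlock (n : ℕ) (c : ℂ) : Matrix (Fin n) (Fin n) ℂ := fun i j =>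
  if i = j then c else if i.val + 1 = j.val then 1 else 0

/-- The matrix in Jordan normal form of type `T` with eigenvalues `c`. -/
def JordanType.jordanMatrix (T : JordanType) (c : Fin T.s → ℂ) :
    Matrix (Σ b : T.Block, Fin (T.blockSize b)) (Σ b : T.Block, Fin (T.blockSize b)) ℂ :=
  Matrix.blockDiagonal' fun b => jordanBlock (T.blockSize b) (c b.1)

variable {B : Scheme.{0}} [B.Over (Spec (.of ℂ))]

/-- A section of the sheaf of differentials of `B` over `U`, given by its values on the affine
open subsets. -/
structure DifferentialForm (U : B.Opens) where
  val : ∀ V : B.affineOpens, V.1 ≤ U → Ω[Γ(B, V.1)⁄ℂ]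
  res : ∀ (V V' : B.affineOpens) (hV : V.1 ≤ U) (h : V'.1 ≤ V.1),
    val V' (h.trans hV) = formMap (resFun h) (val V hV)

/-- The value `a(p)` at the point `p` given by `χ` of the coefficient of a form `a ω`. -/
noncomputable def IsCoframe.coeffAt {A : Type} [CommRing A] [Algebra ℂ A] {ω : Ω[A⁄ℂ]}
    (hω : IsCoframe ω) (χ : A →ₐ[ℂ] ℂ) (η : Ω[A⁄ℂ]) : ℂ :=
  χ (hω.basis.repr η ())

namespace HiggsBundle

variable {r : ℕ} (𝔈 : HiggsBundle B r)

/-- On `U`, the Jordan type of the Higgs field is constantly `T`, with eigenvalues `eig`: in any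
local trivialization and at any closed point, the eigenvalues take pairwise different values and the
matrix of the Higgs field has a Jordan normal form of type `T` with these eigenvalues. -/
def HasConstantJordanType (U : B.Opens) (T : JordanType) (eig : Fin T.s → DifferentialForm U) :
    Prop :=
  ∀ (t : 𝔈.Trivialization) (ht : t.V.toOpens ≤ U) (χ : Γ(B, t.V.toOpens) →ₐ[ℂ] ℂ),
    let c : Fin T.s → ℂ := fun v =>
      t.isCoframe.coeffAt χ ((eig v).val ⟨t.V.toOpens, t.V.2⟩ ht)
    Function.Injective c ∧
      ∃ b : Module.Basis (Σ b : T.Block, Fin (T.blockSize b)) ℂ (Fin r → ℂ),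
        LinearMap.toMatrix b b (Matrix.toLin' (t.matrix.map χ)) = T.jordanMatrix c

/-- The Higgs field is diagonalizable on `U`: locally on `U` there is a frame of the bundle which
consists of eigenvectors of the Higgs field. -/
def IsDiagonalizableOn (U : B.Opens) : Prop :=
  ∀ x ∈ U, ∃ V : B.affineOpens, x ∈ V.1 ∧ V.1 ≤ U ∧ ∃ e : Fin r → Γ(𝔈.E, V.1),
    IsFrame 𝔈.E e ∧ ∃ ω : Fin r → Ω[Γ(B, V.1)⁄ℂ], ∀ i, 𝔈.φ V (e i) = e i ⊗ₜ ω i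

end HiggsBundle
end JordanTypes

/-!
Over the domain of a local trivialization with coordinate ring `A`, the Higgs Grassmannian is the
projective spectrum of `A[z₁, …, zᵣ] / (∑ₖ zₖ (Φⱼₖ zᵢ - Φᵢₖ zⱼ))`, the scheme of eigenlines of the
matrix `Φ` of the Higgs field. Both claims are local on `U` (`HiggsBundle.isFinite_of_forall_exists`,
`HiggsBundle.isReduced_of_forall_exists`) and pass to the local models, so they reduce to statements
about a matrix `Φ` over a reduced finitely generated `ℂ`-algebra `A` which has a constant Jordan type
in the sense of `HasJordanType`. By the Nullstellensatz these are tested at the complex points of `A`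
and of the affine cone over the scheme of eigenlines; the latter are zero or eigenvectors.

*Finiteness.* The eigenspace of an eigenvalue at a complex point has as its dimension the number of
Jordan blocks with this eigenvalue. If there are two of them, the fibre contains a pencil of
eigenlines `e + t f` and is infinite (`HasJordanType.injective_of_isFinite_projToSpec`). If there is
always only one, the fibre consists of finitely many eigenlines, and some linear form vanishes on
none of them. So the fibre lies in an affine open subset, and by properness so does the preimage of
a neighbourhood. The projection is thus affine and proper, hence finite
(`HasJordanType.isFinite_projToSpec`).

*Reducedness.* The polynomial `P = ∏ᵥ (X - λᵥ)` kills all eigenvectors, so the coordinates of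
`P(Φ) z` are nilpotent. If a Jordan block has size at least two, with chain `f ↦ e ↦ 0` under
`Φ - λ`, then the first order deformation `e + ε f` is a tangent vector of the scheme of eigenlines
on which `P(Φ) z` does not vanish, so the scheme is not reduced (`HasJordanType.blockSize_eq_one`).
If all blocks have size one, then `P(Φ) = 0`, and the operators `∏_{w ≠ v} (Φ - λ_w)` extend the
eigenbasis at a complex point to eigensections on a neighbourhood
(`HasJordanType.exists_eigenmatrix`). Conversely, if `Φ` is diagonal, its entries are locally among
the `λᵥ`, whose differences are units; the equations of the scheme of eigenlines then become
`zᵢ zⱼ = 0` for all `i`, `j` with different eigenvalues, and the ideal generated by these squarefree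
monomials is radical (`isReduced_higgsRing_diagonal`). This needs that a smooth curve is reduced
(`isReduced_of_smoothOfRelativeDimension`).
-/

/-! ### Complex points of finitely generated algebras -/

section Nullstellensatz

theorem exists_algHom_ker_eq {R : Type} [CommRing R] [Algebra ℂ R] [Algebra.FiniteType ℂ R]
    (m : Ideal R) [hm : m.IsMaximal] : ∃ χ : R →ₐ[ℂ] ℂ, RingHom.ker χ = m := by
  let _ : Field (R ⧸ m) := Ideal.Quotient.field m
  have : Module.Finite ℂ (R ⧸ m) := finite_of_finite_type_of_isJacobsonRing ℂ (R ⧸ m)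
  let e : (R ⧸ m) →ₐ[ℂ] ℂ := IsAlgClosed.lift
  refine ⟨e.comp (Ideal.Quotient.mkₐ ℂ m), ?_⟩
  ext x
  simp only [RingHom.mem_ker, AlgHom.comp_apply]
  rw [map_eq_zero_iff e e.toRingHom.injective]
  exact Ideal.Quotient.eq_zero_iff_mem

theorem mem_radical_of_forall_algHom {R : Type} [CommRing R] [Algebra ℂ R]
    [Algebra.FiniteType ℂ R] {I : Ideal R} {x : R}
    (h : ∀ χ : R →ₐ[ℂ] ℂ, I ≤ RingHom.ker χ → χ x = 0) : x ∈ I.radical := by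
  have : IsJacobsonRing R := isJacobsonRing_of_finiteType (A := ℂ)
  rw [Ideal.radical_eq_jacobson, Ideal.jacobson, Ideal.mem_sInf]
  rintro m ⟨hm, hm'⟩
  obtain ⟨χ, hχ⟩ := exists_algHom_ker_eq m
  rw [← hχ, RingHom.mem_ker]
  exact h χ (hχ ▸ hm)

theorem eq_zero_of_forall_algHom {R : Type} [CommRing R] [Algebra ℂ R]
    [Algebra.FiniteType ℂ R] [_root_.IsReduced R] {x : R}
    (h : ∀ χ : R →ₐ[ℂ] ℂ, χ x = 0) : x = 0 := by
  have : x ∈ (⊥ : Ideal R).radical := mem_radical_of_forall_algHom fun χ _ => h χ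
  exact (mem_nilradical.mp this).eq_zero

end Nullstellensatz

/-! ### Eigenvectors of matrices in Jordan normal form -/

section Jordan

variable {r : ℕ} {M : Matrix (Fin r) (Fin r) ℂ} {T : JordanType} {c : Fin T.s → ℂ}
  {b : Module.Basis (Σ b : T.Block, Fin (T.blockSize b)) ℂ (Fin r → ℂ)}

theorem JordanType.blockSize_pos (T : JordanType) (β : T.Block) : 0 < T.blockSize β :=
  T.size_pos _ _

/-- The action of a matrix in the coordinates of a Jordan basis. -/
theorem repr_mulVec_of_toMatrix_eq
    (hb : LinearMap.toMatrix b b (Matrix.toLin' M) = T.jordanMatrix c)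
    (x : Fin r → ℂ) (β : T.Block) (i : Fin (T.blockSize β)) :
    b.repr (M.mulVec x) ⟨β, i⟩ = c β.1 * b.repr x ⟨β, i⟩ +
      if h : i.1 + 1 < T.blockSize β then b.repr x ⟨β, ⟨i.1 + 1, h⟩⟩ else 0 := by
  have h1 := congrFun (LinearMap.toMatrix_mulVec_repr b b (Matrix.toLin' M) x) ⟨β, i⟩
  rw [Matrix.toLin'_apply] at h1
  rw [← h1, hb, JordanType.jordanMatrix, Matrix.mulVec, dotProduct, Fintype.sum_sigma,
    Finset.sum_eq_single β]
  · simp only [Matrix.blockDiagonal'_apply_eq, jordanBlock]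
    rw [← Finset.add_sum_erase _ _ (Finset.mem_univ i), if_pos rfl]
    congr 1
    split_ifs with h
    · rw [Finset.sum_eq_single ⟨i.1 + 1, h⟩]
      · rw [if_neg (fun e => by simpa using congrArg Fin.val e), if_pos rfl, one_mul]
      · intro j hj hj'
        rw [if_neg (Finset.ne_of_mem_erase hj).symm, if_neg, zero_mul]
        exact fun e => hj' (Fin.ext e.symm)
      · intro hj
        refine absurd (Finset.mem_erase.mpr ⟨fun e => ?_, Finset.mem_univ _⟩) hj
        simpa using congrArg Fin.val e
    · refine Finset.sum_eq_zero fun j hj => ?_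
      rw [if_neg (Finset.ne_of_mem_erase hj).symm, if_neg, zero_mul]
      intro e
      exact h (e ▸ j.2)
  · intro β' _ hβ
    refine Finset.sum_eq_zero fun j _ => ?_
    rw [Matrix.blockDiagonal'_apply_ne _ _ _ hβ.symm, zero_mul]
  · exact fun h => absurd (Finset.mem_univ _) h

/-- The first vector of a Jordan chain is an eigenvector. -/
theorem mulVec_first_basis_vector
    (hb : LinearMap.toMatrix b b (Matrix.toLin' M) = T.jordanMatrix c) (β : T.Block) :
    M.mulVec (b ⟨β, ⟨0, T.blockSize_pos β⟩⟩) = c β.1 • b ⟨β, ⟨0, T.blockSize_pos β⟩⟩ := by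
  refine b.ext_elem fun ⟨γ, i⟩ => ?_
  rw [repr_mulVec_of_toMatrix_eq hb, map_smul, Module.Basis.repr_self]
  simp only [Finsupp.smul_apply, smul_eq_mul]
  have h0 : (if h : i.1 + 1 < T.blockSize γ then
      (Finsupp.single (⟨β, ⟨0, T.blockSize_pos β⟩⟩ : Σ b : T.Block, Fin (T.blockSize b)) (1 : ℂ))
        ⟨γ, ⟨i.1 + 1, h⟩⟩ else 0) = 0 := by
    split_ifs with h
    · refine Finsupp.single_eq_of_ne fun e => ?_
      obtain ⟨rfl, e⟩ := Sigma.mk.inj_iff.mp e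
      simpa using congrArg Fin.val (eq_of_heq e)
    · rfl
  rw [h0, add_zero, Finsupp.single_apply]
  split_ifs with h
  · obtain ⟨rfl, -⟩ := Sigma.mk.inj_iff.mp h
    rfl
  · simp

/-- The second vector `f` of a Jordan chain satisfies `(M - c) f = e` for the first vector `e`. -/
theorem mulVec_second_basis_vector
    (hb : LinearMap.toMatrix b b (Matrix.toLin' M) = T.jordanMatrix c) (β : T.Block)
    (hβ : 1 < T.blockSize β) :
    M.mulVec (b ⟨β, ⟨1, hβ⟩⟩) =
      c β.1 • b ⟨β, ⟨1, hβ⟩⟩ + b ⟨β, ⟨0, T.blockSize_pos β⟩⟩ := by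
  refine b.ext_elem fun ⟨γ, i⟩ => ?_
  rw [repr_mulVec_of_toMatrix_eq hb, map_add, map_smul, Module.Basis.repr_self,
    Module.Basis.repr_self]
  simp only [Finsupp.smul_apply, Finsupp.add_apply, smul_eq_mul]
  congr 1
  · rw [Finsupp.single_apply]
    split_ifs with h
    · obtain ⟨rfl, -⟩ := Sigma.mk.inj_iff.mp h
      rfl
    · simp
  · by_cases h : γ = β
    · subst h
      rw [Finsupp.single_apply]
      by_cases hi : i.1 = 0
      · obtain rfl : i = ⟨0, T.blockSize_pos γ⟩ := Fin.ext hi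
        simp [hβ]
      · rw [if_neg fun e => hi ?_]
        · split_ifs with h
          · refine Finsupp.single_eq_of_ne fun e => ?_
            obtain ⟨-, e⟩ := Sigma.mk.inj_iff.mp e
            have := congrArg Fin.val (eq_of_heq e)
            simp at this
            omega
          · rfl
        · obtain ⟨-, e⟩ := Sigma.mk.inj_iff.mp e
          exact (congrArg Fin.val (eq_of_heq e)).symm
    · rw [Finsupp.single_eq_of_ne (fun e => h (Sigma.mk.inj_iff.mp e).1)]
      split_ifs
      · exact Finsupp.single_eq_of_ne (fun e => h (Sigma.mk.inj_iff.mp e).1)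
      · rfl

/-- An eigenvector only involves the first vectors of the Jordan chains with its eigenvalue. -/
theorem repr_eq_zero_of_mulVec_eq_smul
    (hb : LinearMap.toMatrix b b (Matrix.toLin' M) = T.jordanMatrix c) {x : Fin r → ℂ} {μ : ℂ}
    (hx : M.mulVec x = μ • x) (β : T.Block) (i : Fin (T.blockSize β))
    (hi : i.1 ≠ 0 ∨ c β.1 ≠ μ) : b.repr x ⟨β, i⟩ = 0 := by
  have key : ∀ i : Fin (T.blockSize β), (c β.1 - μ) * b.repr x ⟨β, i⟩ +
      (if h : i.1 + 1 < T.blockSize β then b.repr x ⟨β, ⟨i.1 + 1, h⟩⟩ else 0) = 0 := by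
    intro i
    have := repr_mulVec_of_toMatrix_eq hb x β i
    rw [hx, map_smul, Finsupp.smul_apply, smul_eq_mul] at this
    linear_combination -this
  by_cases hc : c β.1 = μ
  · obtain hi | hi := hi
    · have hi1 : i.1 - 1 + 1 = i.1 := by omega
      have := key ⟨i.1 - 1, by omega⟩
      rw [hc, sub_self, zero_mul, zero_add, dif_pos (by simp [hi1])] at this
      simpa only [hi1] using this
    · exact absurd hc hi
  · -- the coordinates of such a block vanish one after the other, from the last one downwards
    have hc' : c β.1 - μ ≠ 0 := sub_ne_zero.mpr hc
    clear hi
    induction h : T.blockSize β - 1 - i.1 generalizing i with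
    | zero =>
      have := key i
      rw [dif_neg (by omega), add_zero] at this
      exact (mul_eq_zero.mp this).resolve_left hc'
    | succ n ih =>
      have := key i
      rw [dif_pos (by omega), ih ⟨i.1 + 1, by omega⟩ (by simp; omega), add_zero] at this
      exact (mul_eq_zero.mp this).resolve_left hc'

/-- Every eigenvalue belongs to a Jordan block, and an eigenvector has a nonzero coordinate at the first
vector of some Jordan chain with its eigenvalue. -/
theorem exists_block_of_mulVec_eq_smul
    (hb : LinearMap.toMatrix b b (Matrix.toLin' M) = T.jordanMatrix c) {x : Fin r → ℂ} {μ : ℂ}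
    (hx : M.mulVec x = μ • x) (hx0 : x ≠ 0) : ∃ β : T.Block, c β.1 = μ ∧
      b.repr x ⟨β, ⟨0, T.blockSize_pos β⟩⟩ ≠ 0 := by
  by_contra! H
  refine hx0 (b.ext_elem fun ⟨β, i⟩ => ?_)
  rw [map_zero, Finsupp.zero_apply]
  by_cases h : i.1 ≠ 0 ∨ c β.1 ≠ μ
  · exact repr_eq_zero_of_mulVec_eq_smul hb hx β i h
  · push Not at h
    obtain rfl : i = ⟨0, T.blockSize_pos β⟩ := Fin.ext h.1
    exact H β h.2

/-- If every eigenvalue has only one Jordan block, then its eigenspace is a line. -/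
theorem eq_smul_of_mulVec_eq_smul
    (hb : LinearMap.toMatrix b b (Matrix.toLin' M) = T.jordanMatrix c)
    (hc : Function.Injective fun β : T.Block => c β.1) {x : Fin r → ℂ} {μ : ℂ}
    (hx : M.mulVec x = μ • x) (hx0 : x ≠ 0) :
    ∃ (β : T.Block) (a : ℂ), a ≠ 0 ∧ x = a • b ⟨β, ⟨0, T.blockSize_pos β⟩⟩ := by
  obtain ⟨β, hβ, hβ0⟩ := exists_block_of_mulVec_eq_smul hb hx hx0
  refine ⟨β, _, hβ0, b.ext_elem fun ⟨γ, i⟩ => ?_⟩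
  rw [map_smul, Module.Basis.repr_self, Finsupp.smul_apply]
  by_cases h : i.1 ≠ 0 ∨ c γ.1 ≠ μ
  · rw [repr_eq_zero_of_mulVec_eq_smul hb hx γ i h, Finsupp.single_eq_of_ne, smul_zero]
    rintro e
    obtain ⟨rfl, e⟩ := Sigma.mk.inj_iff.mp e
    obtain rfl := eq_of_heq e
    simp [hβ] at h
  · push Not at h
    obtain rfl : γ = β := hc (h.2.trans hβ.symm)
    obtain rfl : i = ⟨0, T.blockSize_pos γ⟩ := Fin.ext h.1
    simp

end Jordan

/-! ### Polynomials in matrices -/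

section PolynomialsInMatrices
open Polynomial

variable {n : Type} [Fintype n] [DecidableEq n] {K : Type} [CommRing K]

theorem aeval_mulVec_of_mulVec_eq_smul {M : Matrix n n K} {x : n → K} {μ : K}
    (hx : M.mulVec x = μ • x) (q : K[X]) : (aeval M q).mulVec x = q.eval μ • x := by
  induction q using Polynomial.induction_on' with
  | add p q hp hq => rw [map_add, Matrix.add_mulVec, hp, hq, eval_add, add_smul]
  | monomial k a =>
    rw [aeval_monomial, eval_monomial, ← Algebra.smul_def, Matrix.smul_mulVec, mul_smul]
    congr 1
    induction k with
    | zero => simp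
    | succ k ih => rw [pow_succ, ← Matrix.mulVec_mulVec, hx, Matrix.mulVec_smul, ih, smul_smul,
        pow_succ']

theorem map_aeval_matrix {A L : Type} [CommRing A] [CommRing L] (χ : A →+* L)
    (M : Matrix n n A) (q : A[X]) : (aeval M q).map χ = aeval (M.map χ) (q.map χ) := by
  refine Polynomial.map_aeval_eq_aeval_map (φ := χ) (ψ := χ.mapMatrix) ?_ q M
  ext a i j
  simp [Matrix.algebraMap_matrix_apply, apply_ite χ]

end PolynomialsInMatrices

/-! ### The affine cone over the scheme of eigenlines -/

section EigenlineRing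
open MvPolynomial

variable {A S : Type} [CommRing A] [CommRing S] {r : ℕ} {Φ : Matrix (Fin r) (Fin r) A}

/-- The homogeneous coordinate `zᵢ`. -/
noncomputable def higgsX (Φ : Matrix (Fin r) (Fin r) A) (i : Fin r) : HiggsRing Φ :=
  Ideal.Quotient.mk _ (X i)

theorem higgsX_mem (i : Fin r) : higgsX Φ i ∈ higgsGrading Φ 1 :=
  ⟨X i, isHomogeneous_X A i, rfl⟩

theorem eval₂Hom_higgsForm (χ : A →+* S) (z : Fin r → S) (i j : Fin r) :
    eval₂Hom χ z (higgsForm Φ i j) =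
      (Φ.map χ).mulVec z j * z i - (Φ.map χ).mulVec z i * z j := by
  simp [higgsForm_eq, Matrix.mulVec, dotProduct]

/-- A point of the affine cone over the scheme of eigenlines: a vector `z` such that `z` and `Φ z`
are proportional. -/
noncomputable def higgsLift (χ : A →+* S) (z : Fin r → S)
    (hz : ∀ i j, (Φ.map χ).mulVec z j * z i = (Φ.map χ).mulVec z i * z j) : HiggsRing Φ →+* S :=
  Ideal.Quotient.lift _ (eval₂Hom χ z) fun p hp => by
    have : higgsIdeal Φ ≤ RingHom.ker (eval₂Hom χ z) := by
      rw [higgsIdeal, Ideal.span_le]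
      rintro _ ⟨i, j, -, rfl⟩
      rw [SetLike.mem_coe, RingHom.mem_ker, eval₂Hom_higgsForm, hz, sub_self]
    exact RingHom.mem_ker.mp (this hp)

theorem proportional_of_mulVec_eq_smul {M : Matrix (Fin r) (Fin r) S} {z : Fin r → S} {μ : S}
    (h : M.mulVec z = μ • z) (i j : Fin r) : M.mulVec z j * z i = M.mulVec z i * z j := by
  rw [h, Pi.smul_apply, Pi.smul_apply, smul_eq_mul, smul_eq_mul]
  ring

theorem higgsLift_X (χ : A →+* S) (z : Fin r → S) (hz) (i : Fin r) :
    higgsLift (Φ := Φ) χ z hz (higgsX Φ i) = z i :=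
  (Ideal.Quotient.lift_mk _ _ _).trans (eval₂Hom_X' χ z i)

theorem higgsLift_algebraMap (χ : A →+* S) (z : Fin r → S) (hz) (a : A) :
    higgsLift (Φ := Φ) χ z hz (algebraMap A _ a) = χ a :=
  (Ideal.Quotient.lift_mk (a := C a) _ _ _).trans (eval₂Hom_C χ z a)

/-- A complex point of the affine cone is zero or an eigenvector. -/
theorem mulVec_eq_smul_of_hom {ψ : HiggsRing Φ →+* ℂ} {z : Fin r → ℂ}
    (hz : ∀ i, z i = ψ (higgsX Φ i)) (hz0 : z ≠ 0) :
    ∃ μ : ℂ, (Φ.map (ψ.comp (algebraMap A _))).mulVec z = μ • z := by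
  have h1 : ψ.comp (Ideal.Quotient.mk _) =
      eval₂Hom (ψ.comp (algebraMap A _)) z := by
    refine MvPolynomial.ringHom_ext (fun a => ?_) fun i => ?_
    · rw [eval₂Hom_C]
      rfl
    · rw [eval₂Hom_X', hz]
      rfl
  obtain ⟨k, hk⟩ := Function.ne_iff.mp hz0
  rw [Pi.zero_apply] at hk
  refine ⟨(Φ.map (ψ.comp (algebraMap A _))).mulVec z k / z k, funext fun i => ?_⟩
  have h2 := congr($h1 (higgsForm Φ i k))
  rw [eval₂Hom_higgsForm, RingHom.comp_apply,
    Ideal.Quotient.eq_zero_iff_mem.mpr (higgsForm_mem Φ i k), map_zero] at h2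
  rw [Pi.smul_apply, smul_eq_mul]
  field_simp
  linear_combination h2

/-- The linear form `∑ⱼ lⱼ zⱼ`. -/
noncomputable def higgsLinear (Φ : Matrix (Fin r) (Fin r) A) (l : Fin r → A) : HiggsRing Φ :=
  Ideal.Quotient.mk _ (∑ j, C (l j) * X j)

theorem higgsLinear_mem (l : Fin r → A) : higgsLinear Φ l ∈ higgsGrading Φ 1 :=
  ⟨_, IsHomogeneous.sum _ _ _ fun j _ => by
    simpa using (isHomogeneous_C (Fin r) (l j)).mul (isHomogeneous_X A j), rfl⟩

theorem map_higgsLinear (ψ : HiggsRing Φ →+* S) (l : Fin r → A) :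
    ψ (higgsLinear Φ l) = ∑ j, ψ (algebraMap A _ (l j)) * ψ (higgsX Φ j) := by
  rw [higgsLinear, map_sum, map_sum]
  exact Finset.sum_congr rfl fun j _ => by rw [map_mul, map_mul]; rfl

instance [Algebra ℂ A] [Algebra.FiniteType ℂ A] : Algebra.FiniteType ℂ (HiggsRing Φ) := by
  have : Algebra.FiniteType ℂ (MvPolynomial (Fin r) A) := Algebra.FiniteType.trans ‹_› inferInstance
  infer_instance

/-- The homomorphism of `ℂ`-algebras on the base ring induced by a complex point. -/
noncomputable def basePoint [Algebra ℂ A] (ψ : HiggsRing Φ →ₐ[ℂ] ℂ) : A →ₐ[ℂ] ℂ :=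
  ψ.comp (IsScalarTower.toAlgHom ℂ A (HiggsRing Φ))

theorem mulVec_eq_smul_of_algHom [Algebra ℂ A] {ψ : HiggsRing Φ →ₐ[ℂ] ℂ}
    (hz0 : (fun i => ψ (higgsX Φ i)) ≠ 0) :
    ∃ μ : ℂ, (Φ.map (basePoint ψ)).mulVec (fun i => ψ (higgsX Φ i)) =
      μ • fun i => ψ (higgsX Φ i) :=
  mulVec_eq_smul_of_hom (ψ := ψ.toRingHom) (fun _ => rfl) hz0

/-- If a matrix `N` kills all eigenvectors of `Φ` at all complex points, then the coordinates of
`N z` are nilpotent functions on the scheme of eigenlines. -/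
theorem isNilpotent_higgsLinear [Algebra ℂ A] [Algebra.FiniteType ℂ A]
    (N : Matrix (Fin r) (Fin r) A)
    (hN : ∀ (χ : A →ₐ[ℂ] ℂ) (z : Fin r → ℂ) (μ : ℂ), z ≠ 0 → (Φ.map χ).mulVec z = μ • z →
      (N.map χ).mulVec z = 0) (i : Fin r) : IsNilpotent (higgsLinear Φ (N i)) := by
  have : higgsLinear Φ (N i) ∈ (⊥ : Ideal (HiggsRing Φ)).radical := by
    refine mem_radical_of_forall_algHom fun ψ _ => ?_
    have h1 : ψ (higgsLinear Φ (N i)) = (N.map (basePoint ψ)).mulVec (fun i => ψ (higgsX Φ i)) i :=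
      map_higgsLinear ψ.toRingHom (N i)
    rw [h1]
    by_cases hz : (fun i => ψ (higgsX Φ i)) = 0
    · rw [hz, Matrix.mulVec_zero, Pi.zero_apply]
    · obtain ⟨μ, hμ⟩ := mulVec_eq_smul_of_algHom hz
      rw [hN _ _ μ hz hμ, Pi.zero_apply]
  exact mem_nilradical.mp this

/-- A first order deformation `e + ε f` of an eigenvector `e` is a point of the scheme of eigenlines
with values in the dual numbers if `f` continues `e` to a Jordan chain. At this point a linear form
`l` takes the value `l(e) + ε l(f)`. -/
theorem exists_dualNumber_hom (χ : A →+* ℂ) {e f : Fin r → ℂ} {μ : ℂ}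
    (he : (Φ.map χ).mulVec e = μ • e) (hf : (Φ.map χ).mulVec f = μ • f + e) :
    ∃ ψ : HiggsRing Φ →+* DualNumber ℂ,
      (∀ i, ψ (higgsX Φ i) = TrivSqZeroExt.inl (e i) + TrivSqZeroExt.inr (f i)) ∧
      ∀ l : Fin r → A, ψ (higgsLinear Φ l) = TrivSqZeroExt.inl (∑ i, χ (l i) * e i) +
        TrivSqZeroExt.inr (∑ i, χ (l i) * f i) := by
  let χ' : A →+* DualNumber ℂ := (TrivSqZeroExt.inlHom ℂ ℂ).comp χ
  let z : Fin r → DualNumber ℂ := fun i => TrivSqZeroExt.inl (e i) + TrivSqZeroExt.inr (f i)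
  have key : ∀ l : Fin r → A, ∑ i, χ' (l i) * z i =
      TrivSqZeroExt.inl (∑ i, χ (l i) * e i) + TrivSqZeroExt.inr (∑ i, χ (l i) * f i) := by
    intro l
    ext <;> simp [χ', z, TrivSqZeroExt.fst_sum, TrivSqZeroExt.snd_sum]
  have hmul : ∀ i, (Φ.map χ').mulVec z i =
      TrivSqZeroExt.inl (μ * e i) + TrivSqZeroExt.inr (μ * f i + e i) := by
    intro i
    have h1 : ∑ j, χ (Φ i j) * e j = μ * e i := congrFun he i
    have h2 : ∑ j, χ (Φ i j) * f j = μ * f i + e i := congrFun hf i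
    rw [← h1, ← h2]
    exact key (Φ i)
  refine ⟨higgsLift χ' z fun i j => ?_, fun i => higgsLift_X _ _ _ i, fun l => ?_⟩
  · rw [hmul, hmul]
    ext
    · simp [z]; ring
    · simp [z]; ring
  · rw [map_higgsLinear, ← key]
    simp only [higgsLift_X, higgsLift_algebraMap]

/-- For a diagonal matrix whose entries are pairwise equal or differ by a unit, the ideal of the
scheme of eigenlines is a squarefree monomial ideal, hence radical. -/
theorem isReduced_higgsRing_diagonal [_root_.IsReduced A] (a : Fin r → A)
    (ha : ∀ i j, a i = a j ∨ IsUnit (a i - a j)) :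
    _root_.IsReduced (HiggsRing (Matrix.diagonal a)) := by
  classical
  have hform : ∀ i j, higgsForm (Matrix.diagonal a) i j = C (a j - a i) * (X i * X j) := by
    intro i j
    rw [higgsForm_eq]
    simp only [Matrix.diagonal_apply, apply_ite (C : A → MvPolynomial (Fin r) A), map_zero,
      ite_mul, zero_mul, Finset.sum_ite_eq, Finset.mem_univ, if_true, map_sub]
    ring
  refine ⟨fun x hx => ?_⟩
  obtain ⟨p, rfl⟩ := Ideal.Quotient.mk_surjective x
  obtain ⟨n, hn⟩ := hx
  rw [← map_pow, Ideal.Quotient.eq_zero_iff_mem] at hn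
  rw [Ideal.Quotient.eq_zero_iff_mem, p.as_sum]
  refine sum_mem fun m hm => ?_
  -- either two variables of the monomial have different eigenvalues, and it lies in the ideal, or
  -- the monomial survives when all variables with other eigenvalues are set to zero
  by_cases h : ∃ i ∈ m.support, ∃ j ∈ m.support, a i ≠ a j
  · obtain ⟨i, hi, j, hj, hij⟩ := h
    have hu : IsUnit (C (σ := Fin r) (a j - a i)) :=
      ((ha j i).resolve_left (Ne.symm hij)).map C
    have h1 : X i * X j ∈ higgsIdeal (Matrix.diagonal a) := by
      rw [← Ideal.unit_mul_mem_iff_mem _ hu, ← hform]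
      exact higgsForm_mem _ i j
    refine Ideal.mem_of_dvd _ ?_ h1
    have hij' : i ≠ j := fun e => hij (e ▸ rfl)
    have hle : Finsupp.single i 1 + Finsupp.single j 1 ≤ m := by
      intro k
      rw [Finsupp.mem_support_iff] at hi hj
      rw [Finsupp.add_apply, Finsupp.single_apply, Finsupp.single_apply]
      split_ifs with h1 h2 h2
      · exact absurd (h1.trans h2.symm) hij'
      · subst h1; omega
      · subst h2; omega
      · omega
    have : X i * X j = monomial (Finsupp.single i 1 + Finsupp.single j 1) (1 : A) := by
      rw [X, X, monomial_mul, one_mul]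
    rw [this, ← add_tsub_cancel_of_le hle]
    refine ⟨monomial (m - (Finsupp.single i 1 + Finsupp.single j 1)) (coeff m p), ?_⟩
    rw [monomial_mul, one_mul, add_tsub_cancel_of_le hle]
  · push Not at h
    suffices h0 : coeff m p = 0 by rw [h0, map_zero]; exact zero_mem _
    let g : MvPolynomial (Fin r) A →ₐ[A] MvPolynomial (Fin r) A :=
      aeval fun k => if k ∈ m.support then X k else 0
    have hg : higgsIdeal (Matrix.diagonal a) ≤ RingHom.ker g := by
      rw [higgsIdeal, Ideal.span_le]
      rintro _ ⟨i, j, -, rfl⟩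
      rw [SetLike.mem_coe, RingHom.mem_ker, hform, map_mul, map_mul, aeval_X, aeval_X]
      split_ifs with hi hj
      · rw [h i hi j hj, sub_self, map_zero, map_zero, zero_mul]
      · rw [mul_zero, mul_zero]
      · rw [zero_mul, mul_zero]
      · rw [zero_mul, mul_zero]
    have hgp : g p = 0 := by
      have : g p ^ n = 0 := by rw [← map_pow]; exact hg hn
      exact (IsNilpotent.eq_zero ⟨n, this⟩)
    have hmon : ∀ (u : Fin r →₀ ℕ) (c : A), coeff m (g (monomial u c)) = coeff m (monomial u c) := by
      intro u c
      rw [aeval_monomial]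
      by_cases hu : u.support ⊆ m.support
      · rw [monomial_eq, algebraMap_eq]
        refine congrArg (fun q => coeff m (C c * q)) (Finset.prod_congr rfl fun k hk => ?_)
        dsimp only
        rw [if_pos (hu hk)]
      · obtain ⟨k, hk, hk'⟩ := Finset.not_subset.mp hu
        have h0 : (u.prod fun k e => (if k ∈ m.support then X k else 0 : MvPolynomial (Fin r) A) ^ e)
            = 0 := Finset.prod_eq_zero hk (by
          dsimp only
          rw [if_neg hk', zero_pow (Finsupp.mem_support_iff.mp hk)])
        rw [h0, mul_zero, coeff_zero, coeff_monomial, if_neg]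
        rintro rfl
        exact hk' hk
    have hcoeff : coeff m (g p) = coeff m p := by
      conv_lhs => rw [p.as_sum]
      conv_rhs => rw [p.as_sum]
      rw [map_sum, coeff_sum, coeff_sum]
      exact Finset.sum_congr rfl fun u _ => hmon u _
    rw [← hcoeff, hgp, coeff_zero]

end EigenlineRing

/-! ### Matrices of constant Jordan type -/

/-- A nilpotent linear form vanishes where the coordinate `s` is invertible, if the corresponding
chart of the projective spectrum is reduced. -/
theorem exists_pow_mul_eq_zero_of_isReduced_away {A R : Type} [CommRing A] [CommRing R]
    [Algebra A R] {𝒜 : ℕ → Submodule A R} [GradedAlgebra 𝒜] {s x : R} {d : ℕ} (hs : s ∈ 𝒜 d)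
    (hx : x ∈ 𝒜 d) [_root_.IsReduced (Away 𝒜 s)] (hn : IsNilpotent x) :
    ∃ m : ℕ, s ^ m * x = 0 := by
  have hx' : x ∈ 𝒜 (1 • d) := by rwa [one_smul]
  obtain ⟨n, hn⟩ := hn
  have h0 : Away.mk 𝒜 hs 1 x hx' = 0 := by
    refine IsNilpotent.eq_zero ⟨n, HomogeneousLocalization.val_injective _ ?_⟩
    rw [HomogeneousLocalization.val_pow, Away.val_mk, Localization.mk_pow, hn,
      HomogeneousLocalization.val_zero, Localization.mk_zero]
  have h1 := congrArg HomogeneousLocalization.val h0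
  rw [Away.val_mk, HomogeneousLocalization.val_zero, Localization.mk_eq_mk',
    IsLocalization.mk'_eq_zero_iff] at h1
  obtain ⟨⟨_, m, rfl⟩, hm⟩ := h1
  exact ⟨m, hm⟩

section ConstantJordanType
open Polynomial

variable {A : Type} [CommRing A] {r : ℕ} {Φ : Matrix (Fin r) (Fin r) A}
  {T : JordanType} {l : Fin T.s → A}

/-- The product of the linear factors belonging to a set of eigenvalues. -/
noncomputable def eigenProd (l : Fin T.s → A) (s : Finset (Fin T.s)) : A[X] :=
  ∏ v ∈ s, (X - C (l v))

theorem eval_eigenProd_univ (l : Fin T.s → A) (v : Fin T.s) :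
    (eigenProd l Finset.univ).eval (l v) = 0 := by
  rw [eigenProd, eval_prod]
  exact Finset.prod_eq_zero (Finset.mem_univ v) (by simp)

theorem eigenProd_univ_eq (l : Fin T.s → A) (v : Fin T.s) :
    eigenProd l Finset.univ = (X - C (l v)) * eigenProd l (Finset.univ.erase v) :=
  (Finset.mul_prod_erase _ _ (Finset.mem_univ v)).symm

variable [Algebra ℂ A]

theorem map_eigenProd (χ : A →ₐ[ℂ] ℂ) (s : Finset (Fin T.s)) :
    (eigenProd l s).map (χ : A →+* ℂ) = eigenProd (fun v => χ (l v)) s := by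
  simp [eigenProd, Polynomial.map_prod]

theorem map_aeval_eigenProd (χ : A →ₐ[ℂ] ℂ) (s : Finset (Fin T.s)) :
    (aeval Φ (eigenProd l s)).map χ = aeval (Φ.map χ) (eigenProd (fun v => χ (l v)) s) :=
  (map_aeval_matrix (χ : A →+* ℂ) Φ _).trans (by rw [map_eigenProd]; rfl)

theorem eval_eigenProd_erase_ne_zero {c : Fin T.s → ℂ} (hc : Function.Injective c) (v : Fin T.s) :
    (eigenProd c (Finset.univ.erase v)).eval (c v) ≠ 0 := by
  rw [eigenProd, eval_prod]
  refine Finset.prod_ne_zero_iff.mpr fun w hw => ?_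
  rw [eval_sub, eval_X, eval_C, sub_ne_zero]
  exact fun e => Finset.ne_of_mem_erase hw (hc e).symm

/-- At every complex point of `A` the matrix `Φ` has Jordan type `T`, with the values of `l` as
eigenvalues. -/
def HasJordanType (Φ : Matrix (Fin r) (Fin r) A) (T : JordanType) (l : Fin T.s → A) : Prop :=
  ∀ χ : A →ₐ[ℂ] ℂ, Function.Injective (fun v => χ (l v)) ∧
    ∃ b : Module.Basis (Σ b : T.Block, Fin (T.blockSize b)) ℂ (Fin r → ℂ),
      LinearMap.toMatrix b b (Matrix.toLin' (Φ.map χ)) = T.jordanMatrix fun v => χ (l v)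

namespace HasJordanType

/-- The polynomial whose zeros are the eigenvalues kills all eigenvectors. -/
theorem aeval_eigenProd_mulVec (h : HasJordanType Φ T l) (χ : A →ₐ[ℂ] ℂ) {z : Fin r → ℂ} {μ : ℂ}
    (hz0 : z ≠ 0) (hz : (Φ.map χ).mulVec z = μ • z) :
    ((aeval Φ (eigenProd l Finset.univ)).map χ).mulVec z = 0 := by
  obtain ⟨-, b, hb⟩ := h χ
  obtain ⟨β, rfl, -⟩ := exists_block_of_mulVec_eq_smul hb hz hz0
  rw [map_aeval_eigenProd, aeval_mulVec_of_mulVec_eq_smul hz]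
  rw [eval_eigenProd_univ (fun v => χ (l v)) β.1, zero_smul]

/-- A Jordan block of size at least two yields a tangent vector of the scheme of eigenlines on which
the nilpotent functions `∏ᵥ (Φ - λᵥ) z` do not vanish. -/
theorem blockSize_eq_one [Algebra.FiniteType ℂ A] (h : HasJordanType Φ T l)
    (hred : ∀ k, _root_.IsReduced (Away (higgsGrading Φ) (higgsX Φ k))) (χ : A →ₐ[ℂ] ℂ)
    (β : T.Block) : T.blockSize β = 1 := by
  by_contra hβ
  replace hβ : 1 < T.blockSize β := by have := T.blockSize_pos β; omega
  obtain ⟨hinj, b, hb⟩ := h χ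
  have he := mulVec_first_basis_vector hb β
  have hf := mulVec_second_basis_vector hb β hβ
  have he0 := b.ne_zero ⟨β, ⟨0, T.blockSize_pos β⟩⟩
  generalize b ⟨β, ⟨0, T.blockSize_pos β⟩⟩ = e at he hf he0
  generalize b ⟨β, ⟨1, hβ⟩⟩ = f at hf
  obtain ⟨k, hk⟩ := Function.ne_iff.mp he0
  rw [Pi.zero_apply] at hk
  set N := aeval Φ (eigenProd l Finset.univ) with hN
  obtain ⟨ψ, hψX, hψ⟩ := exists_dualNumber_hom (χ : A →+* ℂ) he hf
  have hnil := isNilpotent_higgsLinear (Φ := Φ) N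
    (fun χ z μ hz0 hz => h.aeval_eigenProd_mulVec χ hz0 hz) k
  obtain ⟨m, hm⟩ := exists_pow_mul_eq_zero_of_isReduced_away (higgsX_mem (Φ := Φ) k)
    (higgsLinear_mem (N k)) hnil
  have hu : IsUnit (ψ (higgsX Φ k)) := by
    rw [hψX, TrivSqZeroExt.isUnit_iff_isUnit_fst]
    simpa using hk
  replace hm := congrArg ψ hm
  rw [map_mul, map_pow, map_zero, (hu.pow m).mul_right_eq_zero, hψ] at hm
  replace hm := congrArg TrivSqZeroExt.snd hm
  simp only [TrivSqZeroExt.snd_add, TrivSqZeroExt.snd_inl, TrivSqZeroExt.snd_inr, zero_add,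
    TrivSqZeroExt.snd_zero] at hm
  have h1 : (N.map χ).mulVec f k = 0 := hm
  have h2 : (aeval (Φ.map χ) (X - C (χ (l β.1)))).mulVec f = e := by
    rw [map_sub, aeval_X, aeval_C, Matrix.sub_mulVec, hf, Algebra.algebraMap_eq_smul_one,
      Matrix.smul_mulVec, Matrix.one_mulVec, add_sub_cancel_left]
  rw [hN, map_aeval_eigenProd, eigenProd_univ_eq _ β.1, mul_comm, map_mul, ← Matrix.mulVec_mulVec,
    h2, aeval_mulVec_of_mulVec_eq_smul he, Pi.smul_apply, smul_eq_mul] at h1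
  exact (mul_ne_zero (eval_eigenProd_erase_ne_zero hinj β.1) hk) h1

/-- If all Jordan blocks have size one, then the product of the `Φ - λᵥ` is zero. -/
theorem aeval_eigenProd_eq_zero [Algebra.FiniteType ℂ A] [_root_.IsReduced A]
    (h : HasJordanType Φ T l) (hT : ∀ β : T.Block, T.blockSize β = 1) :
    aeval Φ (eigenProd l Finset.univ) = 0 := by
  refine Matrix.ext fun i j => eq_zero_of_forall_algHom fun χ => ?_
  obtain ⟨hinj, b, hb⟩ := h χ
  have h0 : (aeval Φ (eigenProd l Finset.univ)).map χ = 0 := by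
    refine (Matrix.toLin' (R := ℂ)).injective (b.ext fun ⟨β, i⟩ => ?_)
    obtain rfl : i = ⟨0, T.blockSize_pos β⟩ := Fin.ext (by have := hT β; have := i.2; omega)
    rw [Matrix.toLin'_apply, map_zero, LinearMap.zero_apply]
    exact h.aeval_eigenProd_mulVec χ (b.ne_zero _) (mulVec_first_basis_vector hb β)
  exact congrFun (congrFun h0 i) j

/-- Near a complex point an eigenbasis extends to eigenvectors over the base ring:
`∏_{w ≠ v} (Φ - λ_w)` maps every constant vector to an eigenvector with eigenvalue `λᵥ`. -/
theorem exists_eigenmatrix [Algebra.FiniteType ℂ A] [_root_.IsReduced A]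
    (h : HasJordanType Φ T l) (hT : ∀ β : T.Block, T.blockSize β = 1) (χ : A →ₐ[ℂ] ℂ) :
    ∃ (N : Matrix (Fin r) (Fin r) A) (σ : Fin r → Fin T.s), χ N.det ≠ 0 ∧
      ∀ j, Φ.mulVec (fun i => N i j) = l (σ j) • fun i => N i j := by
  obtain ⟨hinj, b, hb⟩ := h χ
  let ε := (Pi.basisFun ℂ (Fin r)).indexEquiv b
  let σ : Fin r → Fin T.s := fun j => (ε j).1.1
  let x : Fin r → Fin r → A := fun j i => algebraMap ℂ A (b (ε j) i)
  let y : Fin r → Fin r → A := fun j =>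
    (aeval Φ (eigenProd l (Finset.univ.erase (σ j)))).mulVec (x j)
  let a : Fin r → ℂ := fun j =>
    (eigenProd (fun v => χ (l v)) (Finset.univ.erase (σ j))).eval (χ (l (σ j)))
  have ha : ∀ j, a j ≠ 0 := fun j => eval_eigenProd_erase_ne_zero hinj (σ j)
  refine ⟨Matrix.of fun i j => y j i, σ, ?_, fun j => ?_⟩
  · have hy : ∀ j, (fun i => χ (y j i)) = a j • b (ε j) := by
      intro j
      have h1 : (fun i => χ (y j i)) =
          ((aeval Φ (eigenProd l (Finset.univ.erase (σ j)))).map χ).mulVec (b (ε j)) := by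
        refine funext fun i => ?_
        simp [y, x, Matrix.mulVec, dotProduct]
      rw [h1, map_aeval_eigenProd]
      refine aeval_mulVec_of_mulVec_eq_smul ?_ _
      have h2 : ε j = ⟨(ε j).1, ⟨0, T.blockSize_pos _⟩⟩ :=
        Sigma.ext rfl (heq_of_eq (Fin.ext (by
          have := hT (ε j).1; have := (ε j).2.2; simp only; omega)))
      rw [h2]
      exact mulVec_first_basis_vector hb _
    have hli : LinearIndependent ℂ fun j => a j • b (ε j) :=
      (b.linearIndependent.comp ε ε.injective).units_smul fun j => Units.mk0 (a j) (ha j)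
    have h3 : IsUnit (Matrix.of fun j => a j • b (ε j)) :=
      Matrix.linearIndependent_rows_iff_isUnit.mp hli
    rw [Matrix.isUnit_iff_isUnit_det, isUnit_iff_ne_zero] at h3
    have h4 : (χ : A →+* ℂ) (Matrix.of fun i j => y j i).det =
        (Matrix.of fun j => a j • b (ε j)).det := by
      rw [RingHom.map_det, ← Matrix.det_transpose]
      congr 1
      ext j i
      exact congrFun (hy j) i
    exact fun e => h3 (h4.symm.trans e)
  · have h1 : (aeval Φ (X - C (l (σ j)))).mulVec (y j) = 0 := by
      change Matrix.mulVec _ (Matrix.mulVec _ _) = _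
      rw [Matrix.mulVec_mulVec, ← map_mul, ← eigenProd_univ_eq, h.aeval_eigenProd_eq_zero hT,
        Matrix.zero_mulVec]
    rw [map_sub, aeval_X, aeval_C, Matrix.sub_mulVec, Algebra.algebraMap_eq_smul_one,
      Matrix.smul_mulVec, Matrix.one_mulVec, sub_eq_zero] at h1
    exact h1

/-- Two Jordan blocks with the same eigenvalue yield a pencil of eigenvectors `e + t f`. -/
theorem exists_pencil (h : HasJordanType Φ T l) (χ : A →ₐ[ℂ] ℂ) {β γ : T.Block} (hβγ : β ≠ γ)
    (he : β.1 = γ.1) : ∃ (k : Fin r) (e f : Fin r → ℂ) (μ : ℂ), e k = 1 ∧ f k = 0 ∧ f ≠ 0 ∧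
      (Φ.map χ).mulVec e = μ • e ∧ (Φ.map χ).mulVec f = μ • f := by
  obtain ⟨-, b, hb⟩ := h χ
  have hu := mulVec_first_basis_vector hb β
  have hw := mulVec_first_basis_vector hb γ
  rw [← he] at hw
  have hli : LinearIndependent ℂ ![b ⟨β, ⟨0, T.blockSize_pos β⟩⟩, b ⟨γ, ⟨0, T.blockSize_pos γ⟩⟩] := by
    have hne : (⟨β, ⟨0, T.blockSize_pos β⟩⟩ : Σ b : T.Block, Fin (T.blockSize b)) ≠
        ⟨γ, ⟨0, T.blockSize_pos γ⟩⟩ := fun e => hβγ (Sigma.mk.inj_iff.mp e).1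
    have := b.linearIndependent.comp
      ![⟨β, ⟨0, T.blockSize_pos β⟩⟩, ⟨γ, ⟨0, T.blockSize_pos γ⟩⟩] (by
        intro i j hij
        fin_cases i <;> fin_cases j <;> simp_all)
    convert this using 1
    ext i : 1
    fin_cases i <;> rfl
  generalize b ⟨β, ⟨0, T.blockSize_pos β⟩⟩ = u at hu hli
  generalize b ⟨γ, ⟨0, T.blockSize_pos γ⟩⟩ = w at hw hli
  rw [LinearIndependent.pair_iff] at hli
  have hu0 : u ≠ 0 := by
    rintro rfl
    simpa using (hli 1 0 (by simp)).1
  obtain ⟨k, hk⟩ := Function.ne_iff.mp hu0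
  rw [Pi.zero_apply] at hk
  refine ⟨k, (u k)⁻¹ • u, w - (w k / u k) • u, χ (l β.1), ?_, ?_, fun hf => ?_, ?_, ?_⟩
  · simp [hk]
  · simp [hk]
  · have := (hli (-(w k / u k)) 1 (by rw [one_smul, neg_smul, neg_add_eq_sub, hf])).2
    exact one_ne_zero this
  · rw [Matrix.mulVec_smul, hu, smul_comm]
  · rw [Matrix.mulVec_sub, Matrix.mulVec_smul, hu, hw, smul_sub, smul_comm]

/-- If every eigenvalue has only one Jordan block, then some linear form vanishes on none of the
finitely many eigenlines at a complex point. -/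
theorem exists_linearForm (h : HasJordanType Φ T l) (χ : A →ₐ[ℂ] ℂ)
    (hT : Function.Injective fun β : T.Block => β.1) : ∃ ℓ : Fin r → ℂ,
      ∀ (z : Fin r → ℂ) (μ : ℂ), z ≠ 0 → (Φ.map χ).mulVec z = μ • z → ∑ i, ℓ i * z i ≠ 0 := by
  obtain ⟨hinj, b, hb⟩ := h χ
  let L : (Fin r → ℂ) →ₗ[ℂ] ℂ := b.constr ℂ fun _ => 1
  refine ⟨fun i => L (Pi.single i 1), fun z μ hz0 hz => ?_⟩
  obtain ⟨β, a, ha, rfl⟩ := eq_smul_of_mulVec_eq_smul hb (hinj.comp hT) hz hz0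
  have h1 : ∀ y : Fin r → ℂ, ∑ i, L (Pi.single i 1) * y i = L y := by
    intro y
    conv_rhs => rw [← (Pi.basisFun ℂ (Fin r)).sum_repr y]
    simp [mul_comm]
  rw [h1, map_smul, smul_eq_mul, Module.Basis.constr_basis, mul_one]
  exact ha

end HasJordanType
end ConstantJordanType

/-! ### Points and charts of projective spectra -/

section ProjCharts

variable {A R : Type} [CommRing A] [CommRing R] [Algebra A R] (𝒜 : ℕ → Submodule A R)
  [GradedAlgebra 𝒜]

theorem isReduced_away_of_isReduced_proj [AlgebraicGeometry.IsReduced (Proj 𝒜)] {d : ℕ}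
    (hd : 0 < d) {s : R} (hs : s ∈ 𝒜 d) : _root_.IsReduced (Away 𝒜 s) := by
  have : AlgebraicGeometry.IsReduced (Spec (.of (Away 𝒜 s))) :=
    isReduced_of_isOpenImmersion (Proj.awayι 𝒜 s hs hd)
  exact (affine_isReduced_iff _).mp this

theorem isReduced_proj [_root_.IsReduced R] : AlgebraicGeometry.IsReduced (Proj 𝒜) := by
  have key : ∀ s, AlgebraicGeometry.IsReduced ((Proj.affineOpenCover 𝒜).openCover.X s) := by
    intro s
    have h2 : _root_.IsReduced (Away 𝒜 (s.2.1 : R)) :=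
      isReduced_of_injective (algebraMap _ (Localization (Submonoid.powers (s.2.1 : R))))
        (HomogeneousLocalization.val_injective _)
    exact (affine_isReduced_iff _).mpr h2
  exact IsReduced.of_openCover _ (Proj.affineOpenCover 𝒜).openCover

theorem exists_mem_range_awayι (x : Proj 𝒜) : ∃ (d : ℕ) (hd : 0 < d) (s : R) (hs : s ∈ 𝒜 d)
    (y : Spec (.of (Away 𝒜 s))), Proj.awayι 𝒜 s hs hd y = x := by
  obtain ⟨i, y, hy⟩ := (Proj.affineOpenCover 𝒜).openCover.exists_eq x
  exact ⟨i.1, i.1.2, i.2.1, i.2.2, y, hy⟩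

theorem notMem_asIdeal_projToSpec_iff (a : A) (x : Proj 𝒜) :
    a ∉ (projToSpec 𝒜 x).asIdeal ↔ algebraMap A R a ∉ x.asHomogeneousIdeal := by
  obtain ⟨d, hd, s, hs, y, rfl⟩ := exists_mem_range_awayι 𝒜 x
  have hsa : s * algebraMap A R a ∈ 𝒜 d := by
    rw [mul_comm, ← Algebra.smul_def]
    exact Submodule.smul_mem _ _ hs
  have hys : Proj.awayι 𝒜 s hs hd y ∈ Proj.basicOpen 𝒜 s := by
    rw [← Proj.opensRange_awayι 𝒜 s hs hd]
    exact ⟨y, rfl⟩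
  have h2 : Proj.awayι 𝒜 s hs hd y ∈ Proj.basicOpen 𝒜 (s * algebraMap A R a) ↔
      Proj.awayι 𝒜 s hs hd y ∈ Proj.basicOpen 𝒜 (algebraMap A R a) := by
    rw [Proj.basicOpen_mul]
    exact and_iff_right hys
  rw [← Proj.mem_basicOpen, ← h2, ← Scheme.Hom.comp_apply, awayι_projToSpec hd s hs]
  change _ ↔ y ∈ Proj.awayι 𝒜 s hs hd ⁻¹ᵁ Proj.basicOpen 𝒜 (s * algebraMap A R a)
  rw [Proj.awayι_preimage_basicOpen 𝒜 hs hd hsa hd]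
  change _ ↔ Away.isLocalizationElem hs hsa ∉ y.asIdeal
  have h1 : Away.isLocalizationElem hs hsa =
      ((fromZeroRingHom 𝒜 (Submonoid.powers s)).comp (algebraMap A (𝒜 0)) a) ^ d := by
    apply HomogeneousLocalization.val_injective
    rw [HomogeneousLocalization.val_pow, Away.val_mk]
    change _ = (Localization.mk (algebraMap A R a) 1) ^ d
    rw [Localization.mk_pow, one_pow, Localization.mk_eq_mk_iff, Localization.r_iff_exists]
    exact ⟨1, by simp [mul_pow]⟩
  rw [h1, y.2.pow_mem_iff_mem _ hd]
  rfl

/-- The point of the projective spectrum below a point of the affine cone over a field. -/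
theorem exists_proj_point {K : Type} [Field K] (ψ : R →+* K) {s : R} {d : ℕ} (hd : 0 < d)
    (hs : s ∈ 𝒜 d) (hψ : ψ s ≠ 0) : ∃ x : Proj 𝒜,
      (projToSpec 𝒜 x).asIdeal = RingHom.ker (ψ.comp (algebraMap A R)) ∧
      ∀ g ∈ 𝒜 d, x ∈ Proj.basicOpen 𝒜 g ↔ ψ g ≠ 0 := by
  let α₀ : Localization.Away s →+* K := IsLocalization.Away.lift s (isUnit_iff_ne_zero.mpr hψ)
  let α : Away 𝒜 s →+* K := α₀.comp (algebraMap (Away 𝒜 s) (Localization.Away s))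
  have hα₀ : ∀ a, α₀ (algebraMap R _ a) = ψ a := fun a => IsLocalization.Away.lift_eq s _ a
  let y : Spec (.of (Away 𝒜 s)) := ⟨RingHom.ker α, RingHom.ker_isPrime α⟩
  refine ⟨Proj.awayι 𝒜 s hs hd y, ?_, fun g hg => ?_⟩
  · rw [← Scheme.Hom.comp_apply, awayι_projToSpec hd s hs]
    ext a
    change α (((fromZeroRingHom 𝒜 (Submonoid.powers s)).comp (algebraMap A (𝒜 0))) a) = 0 ↔
      ψ (algebraMap A R a) = 0
    rw [← hα₀, ← Localization.mk_one_eq_algebraMap]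
    rfl
  · change y ∈ Proj.awayι 𝒜 s hs hd ⁻¹ᵁ Proj.basicOpen 𝒜 g ↔ _
    rw [Proj.awayι_preimage_basicOpen 𝒜 hs hd hg hd]
    change α (Away.isLocalizationElem (𝒜 := 𝒜) hs hg) ≠ 0 ↔ _
    have h1 : α (Away.isLocalizationElem (𝒜 := 𝒜) hs hg) * ψ s ^ d = ψ g ^ d := by
      change α₀ (HomogeneousLocalization.val (Away.isLocalizationElem (𝒜 := 𝒜) hs hg)) * _ = _
      rw [Away.val_mk, ← map_pow ψ s, ← hα₀, ← map_mul, ← map_pow ψ g, ← hα₀,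
        ← Localization.mk_one_eq_algebraMap, ← Localization.mk_one_eq_algebraMap,
        Localization.mk_mul]
      congr 1
      rw [Localization.mk_eq_mk_iff, Localization.r_iff_exists]
      exact ⟨1, by simp; ring⟩
    have h2 : ψ s ^ d ≠ 0 := pow_ne_zero _ hψ
    constructor
    · intro h3 h4
      rw [h4, zero_pow hd.ne'] at h1
      exact (mul_ne_zero h3 h2) h1
    · intro h3 h4
      rw [h4, zero_mul] at h1
      exact pow_ne_zero d h3 h1.symm

end ProjCharts

/-! ### Finiteness of proper morphisms -/

section ProperAffine

/-- A proper morphism to an affine scheme is finite if its fibre over every closed point is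
contained in an affine open subset. -/
theorem isFinite_of_isProper_of_fibers {A : Type} [CommRing A] {X : Scheme.{0}}
    (f : X ⟶ Spec (.of A)) [IsProper f]
    (h : ∀ m : Ideal A, m.IsMaximal → ∃ W : X.Opens, IsAffineOpen W ∧
      ∀ x : X, (f x).asIdeal = m → x ∈ W) : IsFinite f := by
  rw [IsFinite.iff_isProper_and_isAffineHom]
  refine ⟨inferInstance, isAffineHom_of_forall_exists_isAffineOpen _ fun p => ?_⟩
  obtain ⟨m, hm, hpm⟩ := p.asIdeal.exists_le_maximal p.2.ne_top
  obtain ⟨W, hW, hWm⟩ := h m hm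
  have hcl : IsClosed (f '' (W : Set X)ᶜ) := f.isClosedMap _ W.isOpen.isClosed_compl
  let q : Spec (.of A) := ⟨m, hm.isPrime⟩
  have hq : q ∈ (f '' (W : Set X)ᶜ)ᶜ := by
    rintro ⟨x, hx, hxq⟩
    exact hx (hWm x (by rw [hxq]))
  obtain ⟨_, ⟨_, ⟨a, rfl⟩, rfl⟩, hqa, ha⟩ :=
    PrimeSpectrum.isBasis_basic_opens.exists_subset_of_mem_open hq hcl.isOpen_compl
  obtain ⟨t, ht⟩ : ∃ t, (Spec (.of A)).basicOpen t = PrimeSpectrum.basicOpen a :=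
    ⟨_, basicOpen_eq_of_affine a⟩
  have hfD : f ⁻¹ᵁ (Spec (.of A)).basicOpen t ≤ W := by
    rw [ht]
    intro x hx
    by_contra hxW
    exact ha hx ⟨x, hxW, rfl⟩
  refine ⟨(Spec (.of A)).basicOpen t, ?_, (isAffineOpen_top _).basicOpen t, ?_⟩
  · rw [ht]
    exact fun hp => hqa (hpm hp)
  · have h2 := hW.basicOpen (f.appLE ⊤ W le_top t)
    have h3 := Scheme.basicOpen_appLE f W ⊤ le_top t
    rw [inf_eq_right.mpr hfD] at h3
    exact h3 ▸ h2

end ProperAffine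

/-! ### Properness of the scheme of eigenlines -/

section HiggsProj
open MvPolynomial

variable {A : Type} [CommRing A] {r : ℕ} (Φ : Matrix (Fin r) (Fin r) A)

attribute [local instance] MvPolynomial.gradedAlgebra in
theorem algebraMap_higgsGrading_zero_surjective :
    Function.Surjective (algebraMap A (higgsGrading Φ 0)) := by
  rintro ⟨_, p, hp, rfl⟩
  rw [SetLike.mem_coe, mem_homogeneousSubmodule] at hp
  refine ⟨coeff 0 p, Subtype.ext ?_⟩
  have : p = C (coeff 0 p) := totalDegree_eq_zero_iff_eq_C.mp (Nat.le_zero.mp hp.totalDegree_le)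
  exact congrArg (Ideal.Quotient.mk (higgsIdeal Φ)) this.symm

instance : IsProper (projToSpec (higgsGrading Φ)) := by
  have : IsScalarTower A (higgsGrading Φ 0) (HiggsRing Φ) :=
    IsScalarTower.of_algebraMap_eq (R := A) (S := higgsGrading Φ 0) (A := HiggsRing Φ) fun _ => rfl
  have : Algebra.FiniteType (higgsGrading Φ 0) (HiggsRing Φ) :=
    .of_restrictScalars_finiteType A _ _
  have : IsClosedImmersion (Spec.map (CommRingCat.ofHom (algebraMap A (higgsGrading Φ 0)))) :=
    IsClosedImmersion.spec_of_surjective _ (algebraMap_higgsGrading_zero_surjective Φ)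
  rw [projToSpec]
  infer_instance

end HiggsProj

/-! ### Smooth algebras are reduced -/

section Smooth

/-- A standard smooth algebra over a domain is reduced: it is étale over a polynomial ring, hence
flat over it, and its generic fibre is étale over a field. -/
theorem isReduced_of_isStandardSmoothOfRelativeDimension {k A : Type} [CommRing k] [IsDomain k]
    [CommRing A] [Algebra k A] (n : ℕ) [Algebra.IsStandardSmoothOfRelativeDimension n k A] :
    _root_.IsReduced A := by
  obtain ⟨g, hg⟩ := Algebra.IsStandardSmoothOfRelativeDimension.exists_etale_mvPolynomial n k A
  let R := MvPolynomial (Fin n) k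
  let K := FractionRing R
  let _ : Algebra R A := g.toRingHom.toAlgebra
  have : Algebra.Etale R A := hg
  have : Module.Flat R A := inferInstance
  have : Algebra.Etale K (TensorProduct R K A) := inferInstance
  have : _root_.IsReduced (TensorProduct R K A) :=
    Algebra.FormallyUnramified.isReduced_of_field K _
  refine isReduced_of_injective (Algebra.TensorProduct.includeRight : A →ₐ[R] TensorProduct R K A) ?_
  exact Algebra.TensorProduct.includeRight_injective (IsFractionRing.injective R K)

end Smooth

/-! ### The scheme of eigenlines of a matrix of constant Jordan type -/

section EigenlineScheme
open MvPolynomial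

variable {A : Type} [CommRing A] {r : ℕ}
  {Φ : Matrix (Fin r) (Fin r) A} {T : JordanType} {l : Fin T.s → A}

theorem exists_higgsX_notMem (x : Proj (higgsGrading Φ)) :
    ∃ i, higgsX Φ i ∉ x.asHomogeneousIdeal := by
  by_contra! h
  refine x.not_irrelevant_le ((HomogeneousIdeal.irrelevant_le _).mpr ?_)
  rintro n hn _ ⟨p, hp, rfl⟩
  have h1 : p ∈ Ideal.span (X '' (Set.univ : Set (Fin r))) := by
    rw [mem_ideal_span_X_image]
    intro m hm
    by_contra! h0
    obtain rfl : m = 0 := Finsupp.ext fun i => h0 i (Set.mem_univ i)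
    have := hp (mem_support_iff.mp hm)
    simp at this
    omega
  have h2 : Ideal.span (X '' (Set.univ : Set (Fin r))) ≤
      x.asHomogeneousIdeal.toIdeal.comap (Ideal.Quotient.mk (higgsIdeal Φ)) := by
    rw [Ideal.span_le]
    rintro _ ⟨i, -, rfl⟩
    exact h i
  exact h2 h1

variable [Algebra ℂ A]

/-- Two Jordan blocks with the same eigenvalue give infinitely many points of the fibre over a complex
point, namely the members of a pencil of eigenlines. -/
theorem HasJordanType.injective_of_isFinite_projToSpec (h : HasJordanType Φ T l)
    [IsFinite (projToSpec (higgsGrading Φ))] (χ : A →ₐ[ℂ] ℂ) :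
    Function.Injective fun β : T.Block => β.1 := by
  intro β γ hβγ
  by_contra hne
  obtain ⟨k, e, f, μ, hek, hfk, hf0, he, hf⟩ := h.exists_pencil χ hne hβγ
  obtain ⟨j, hj⟩ := Function.ne_iff.mp hf0
  rw [Pi.zero_apply] at hj
  have hz : ∀ t : ℂ, (Φ.map (χ : A →+* ℂ)).mulVec (e + t • f) = μ • (e + t • f) := by
    intro t
    refine (Matrix.mulVec_add _ _ _).trans ?_
    rw [Matrix.mulVec_smul]
    refine (congrArg₂ (· + t • ·) he hf).trans ?_
    rw [smul_add, smul_comm]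
  let ψ : ℂ → HiggsRing Φ →+* ℂ := fun t =>
    higgsLift (χ : A →+* ℂ) (e + t • f) (proportional_of_mulVec_eq_smul (hz t))
  have hψX : ∀ t i, ψ t (higgsX Φ i) = e i + t * f i := fun t i => higgsLift_X _ _ _ i
  have hψA : ∀ t, (ψ t).comp (algebraMap A _) = (χ : A →+* ℂ) := fun t =>
    RingHom.ext fun a => higgsLift_algebraMap (Φ := Φ) _ _ (proportional_of_mulVec_eq_smul (hz t)) a
  have hψk : ∀ t, ψ t (higgsX Φ k) = 1 := fun t => by rw [hψX, hek, hfk, mul_zero, add_zero]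
  choose x hx hxg using fun t => exists_proj_point (higgsGrading Φ) (ψ t) one_pos (higgsX_mem k)
    (by rw [hψk]; exact one_ne_zero)
  have hinj : Function.Injective x := by
    intro t u htu
    by_contra htu'
    -- the linear form `z_j - (e_j + u f_j) z_k` separates the two points
    let g := higgsLinear Φ
      (Pi.single j 1 - Pi.single k (algebraMap ℂ A (e j + u * f j)))
    have hg : ∀ s, ψ s g = (s - u) * f j := by
      intro s
      have hA : ∀ a : A, ψ s (algebraMap A _ a) = χ a := fun a => congr($(hψA s) a)
      rw [map_higgsLinear]
      simp only [hA, hψX, Pi.sub_apply, map_sub, Pi.single_apply, apply_ite χ, map_one, map_zero,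
        AlgHom.commutes, sub_mul, ite_mul, one_mul, zero_mul, Finset.sum_sub_distrib,
        Finset.sum_ite_eq', Finset.mem_univ, if_true, hek, hfk]
      change e j + s * f j - (e j + u * f j) * (1 + s * 0) = _
      ring
    have h1 := (hxg t g (higgsLinear_mem _)).mpr (by
      rw [hg]; exact mul_ne_zero (sub_ne_zero.mpr htu') hj)
    rw [htu, hxg u g (higgsLinear_mem _), hg, sub_self, zero_mul] at h1
    exact h1 rfl
  let q : Spec (.of A) := ⟨RingHom.ker (χ : A →+* ℂ), RingHom.ker_isPrime _⟩
  have hfin := (projToSpec (higgsGrading Φ)).finite_preimage_singleton q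
  refine (Set.infinite_range_of_injective hinj) (hfin.subset ?_)
  rintro _ ⟨t, rfl⟩
  exact PrimeSpectrum.ext ((hx t).trans (by rw [hψA]))

variable [Algebra.FiniteType ℂ A]

/-- A linear form which vanishes on no eigenline at a complex point has no zero on the fibre of the
scheme of eigenlines. -/
theorem higgsLinear_notMem_of_forall_eigenvector (χ : A →ₐ[ℂ] ℂ) (ℓ : Fin r → ℂ)
    (hℓ : ∀ (z : Fin r → ℂ) (μ : ℂ), z ≠ 0 → (Φ.map χ).mulVec z = μ • z → ∑ i, ℓ i * z i ≠ 0)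
    (x : Proj (higgsGrading Φ)) (hx : (projToSpec (higgsGrading Φ) x).asIdeal = RingHom.ker χ) :
    higgsLinear Φ (fun i => algebraMap ℂ A (ℓ i)) ∉ x.asHomogeneousIdeal := by
  intro hmem
  obtain ⟨k, hk⟩ := exists_higgsX_notMem x
  refine hk ?_
  have hp : x.asHomogeneousIdeal.toIdeal.IsPrime := x.isPrime
  have h1 : higgsX Φ k ∈ x.asHomogeneousIdeal.toIdeal.radical := by
    refine mem_radical_of_forall_algHom fun ψ hψ => ?_
    by_contra h0
    have hz : (fun i => ψ (higgsX Φ i)) ≠ 0 := fun e => h0 (congrFun e k)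
    obtain ⟨μ, hμ⟩ := mulVec_eq_smul_of_algHom hz
    have hχ : basePoint ψ = χ := by
      refine AlgHom.ext fun a => ?_
      have h2 : a - algebraMap ℂ A (χ a) ∈ RingHom.ker χ := by
        rw [RingHom.mem_ker, map_sub, AlgHom.commutes]
        exact sub_self _
      rw [← hx] at h2
      have h3 : algebraMap A (HiggsRing Φ) (a - algebraMap ℂ A (χ a)) ∈ x.asHomogeneousIdeal :=
        not_not.mp fun h => (notMem_asIdeal_projToSpec_iff _ _ x).mpr h h2
      have h4 : basePoint ψ (a - algebraMap ℂ A (χ a)) = 0 := hψ h3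
      rw [map_sub, AlgHom.commutes, sub_eq_zero] at h4
      exact h4
    rw [hχ] at hμ
    refine hℓ _ μ hz hμ ?_
    have h5 : ψ (higgsLinear Φ fun i => algebraMap ℂ A (ℓ i)) = 0 := hψ hmem
    refine Eq.trans ?_ h5
    refine Eq.trans ?_ (map_higgsLinear ψ.toRingHom _).symm
    refine Finset.sum_congr rfl fun i _ => ?_
    congr 1
    exact ((basePoint ψ).commutes (ℓ i)).symm
  rwa [hp.radical] at h1

namespace HasJordanType

/-- If every eigenvalue has only one Jordan block, the fibres over the closed points avoid a hyperplane,
so the proper morphism is finite. -/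
theorem isFinite_projToSpec (h : HasJordanType Φ T l)
    (hT : Function.Injective fun β : T.Block => β.1) : IsFinite (projToSpec (higgsGrading Φ)) := by
  refine isFinite_of_isProper_of_fibers _ fun m hm => ?_
  obtain ⟨χ, rfl⟩ := exists_algHom_ker_eq m
  obtain ⟨ℓ, hℓ⟩ := h.exists_linearForm χ hT
  exact ⟨Proj.basicOpen _ (higgsLinear Φ fun i => algebraMap ℂ A (ℓ i)),
    Proj.isAffineOpen_basicOpen _ _ (higgsLinear_mem _) one_pos,
    fun x hx => higgsLinear_notMem_of_forall_eigenvector χ ℓ hℓ x hx⟩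

theorem blockSize_eq_one_of_isReduced_proj (h : HasJordanType Φ T l)
    [AlgebraicGeometry.IsReduced (Proj (higgsGrading Φ))] (χ : A →ₐ[ℂ] ℂ) (β : T.Block) :
    T.blockSize β = 1 :=
  h.blockSize_eq_one
    (fun k => isReduced_away_of_isReduced_proj _ one_pos (higgsX_mem k)) χ β

/-- Different eigenvalues differ by a unit. -/
theorem isUnit_sub (h : HasJordanType Φ T l) {v w : Fin T.s} (hvw : v ≠ w) :
    IsUnit (l v - l w) := by
  by_contra hu
  obtain ⟨m, hm, hmem⟩ := exists_max_ideal_of_mem_nonunits hu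
  obtain ⟨χ, rfl⟩ := exists_algHom_ker_eq m
  rw [RingHom.mem_ker, map_sub, sub_eq_zero] at hmem
  exact hvw ((h χ).1 hmem)

/-- Locally, the entries of a diagonal matrix of constant Jordan type are among the given
eigenvalues. -/
theorem exists_mul_sub_eq_zero [_root_.IsReduced A] {a : Fin r → A}
    (h : HasJordanType (Matrix.diagonal a) T l) (q : Ideal A) [hq : q.IsPrime] :
    ∃ (g : A) (σ : Fin r → Fin T.s), g ∉ q ∧ ∀ i, g * (a i - l (σ i)) = 0 := by
  have h0 : ∀ i, ∏ v, (a i - l v) = 0 := by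
    refine fun i => eq_zero_of_forall_algHom fun χ => ?_
    obtain ⟨-, b, hb⟩ := h χ
    have he : ((Matrix.diagonal a).map χ).mulVec (Pi.single i 1) = χ (a i) • Pi.single i 1 := by
      rw [Matrix.diagonal_map (map_zero χ)]
      ext k
      by_cases hk : k = i
      · subst hk; simp
      · simp [hk]
    obtain ⟨β, hβ, -⟩ := exists_block_of_mulVec_eq_smul hb he (by simp)
    rw [map_prod]
    exact Finset.prod_eq_zero (Finset.mem_univ β.1) (by rw [map_sub, ← hβ]; exact sub_self _)
  have h1 : ∀ i, ∃ v, a i - l v ∈ q := by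
    intro i
    have : ∏ v, (a i - l v) ∈ q := by rw [h0]; exact zero_mem _
    obtain ⟨v, -, hv⟩ := hq.prod_mem_iff.mp this
    exact ⟨v, hv⟩
  choose σ hσ using h1
  refine ⟨∏ i, ∏ v ∈ Finset.univ.erase (σ i), (a i - l v), σ, fun hmem => ?_, fun i => ?_⟩
  · obtain ⟨i, -, hi⟩ := hq.prod_mem_iff.mp hmem
    obtain ⟨v, hv, hi⟩ := hq.prod_mem_iff.mp hi
    have hu := h.isUnit_sub (Finset.ne_of_mem_erase hv)
    refine hq.ne_top (q.eq_top_of_isUnit_mem ?_ hu)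
    have := sub_mem (hσ i) hi
    rwa [sub_sub_sub_cancel_left] at this
  · rw [← Finset.mul_prod_erase _ _ (Finset.mem_univ i), mul_right_comm,
      Finset.prod_erase_mul _ _ (Finset.mem_univ (σ i)), h0, zero_mul]

end HasJordanType
end EigenlineScheme

/-! ### Smooth curves -/

theorem isZariskiLocalAtTarget_isFinite : IsZariskiLocalAtTarget (@IsFinite.{0}) := by
  have : HasAffineProperty @IsFinite.{0} (affineAnd RingHom.Finite) :=
    (HasAffineProperty.affineAnd_iff _ RingHom.finite_respectsIso
      RingHom.finite_localizationPreserves.away RingHom.finite_ofLocalizationSpan).mpr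
      fun f => isFinite_iff f
  exact HasAffineProperty.instIsZariskiLocalAtTarget

section Curve

variable {B : Scheme.{0}} [B.Over (Spec (.of ℂ))]

theorem finiteType_sections [LocallyOfFiniteType (B ↘ Spec (.of ℂ))] {V : B.Opens}
    (hV : IsAffineOpen V) : Algebra.FiniteType ℂ Γ(B, V) := by
  have h1 := (B ↘ Spec (.of ℂ)).finiteType_appLE (isAffineOpen_top _) hV (by simp)
  have h2 : Function.Surjective ((Scheme.ΓSpecIso (.of ℂ)).inv.hom) :=
    (Scheme.ΓSpecIso (.of ℂ)).symm.commRingCatIsoToRingEquiv.surjective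
  exact h1.comp (RingHom.FiniteType.of_surjective _ h2)

theorem isReduced_of_smoothOfRelativeDimension (n : ℕ)
    [SmoothOfRelativeDimension n (B ↘ Spec (.of ℂ))] : AlgebraicGeometry.IsReduced B := by
  have key : ∀ x : B, ∃ V : B.Opens, x ∈ V ∧ AlgebraicGeometry.IsReduced V.toScheme := by
    intro x
    obtain ⟨U, -, V, hV, hx, e, H⟩ :=
      SmoothOfRelativeDimension.exists_isStandardSmoothOfRelativeDimension
        (n := n) (f := B ↘ Spec (.of ℂ)) x
    obtain rfl : U = ⊤ := by
      refine top_unique fun y _ => ?_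
      have : Subsingleton (PrimeSpectrum ℂ) := inferInstance
      have : y = (B ↘ Spec (.of ℂ)) x := Subsingleton.elim (α := PrimeSpectrum ℂ) _ _
      exact this ▸ e hx
    have h1 : RingHom.IsStandardSmoothOfRelativeDimension n (algebraMap ℂ Γ(B, V)) :=
      RingHom.IsStandardSmoothOfRelativeDimension.comp H
        (RingHom.IsStandardSmoothOfRelativeDimension.equiv
          (Scheme.ΓSpecIso (.of ℂ)).symm.commRingCatIsoToRingEquiv)
    have h2 : Algebra.IsStandardSmoothOfRelativeDimension n ℂ Γ(B, V) :=
      (RingHom.isStandardSmoothOfRelativeDimension_algebraMap n).mp h1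
    have h3 : _root_.IsReduced Γ(B, V) := isReduced_of_isStandardSmoothOfRelativeDimension (k := ℂ) n
    have : _root_.IsReduced (CommRingCat.of Γ(B, V)) := h3
    exact ⟨V, hx, isReduced_of_isOpenImmersion hV.isoSpec.hom⟩
  choose V hx hV using key
  let 𝒰 := Scheme.openCoverOfIsOpenCover B V (TopologicalSpace.IsOpenCover.mk
    (top_unique fun x _ => TopologicalSpace.Opens.mem_iSup.mpr ⟨x, hx x⟩))
  have : ∀ x, AlgebraicGeometry.IsReduced (𝒰.X x) := hV
  exact IsReduced.of_openCover B 𝒰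

end Curve

/-! ### Passing between the Higgs Grassmannian and its local models -/

section Gluing
open Limits

variable {B : Scheme.{0}} [B.Over (Spec (.of ℂ))]

namespace HiggsBundle
variable {r : ℕ} (𝔈 : HiggsBundle B r)

/-- A family of trivializations over open subsets of `U`, one at every point of `U`, covers `U`. -/
noncomputable def coverOfTrivializations {U : B.Opens} (t : U → 𝔈.Trivialization)
    (hU : ∀ x, (t x).V.toOpens ≤ U) (ht : ∀ x, x.1 ∈ (t x).V.toOpens) : U.toScheme.OpenCover where
  I₀ := U
  X x := (t x).V.toOpens
  f x := B.homOfLE (hU x)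
  mem₀ := by
    rw [Scheme.presieve₀_mem_precoverage_iff]
    refine ⟨fun x => ⟨⟨x.1, x.2⟩, ⟨x.1, ht ⟨x.1, x.2⟩⟩, ?_⟩,
      fun x => inferInstanceAs (IsOpenImmersion (B.homOfLE (hU x)))⟩
    exact U.ι.isOpenEmbedding.injective
      congr($(B.homOfLE_ι (hU ⟨x.1, x.2⟩)) ⟨x.1, ht ⟨x.1, x.2⟩⟩)

variable [SmoothOfRelativeDimension 1 (B ↘ Spec (.of ℂ))]

/-- Over the domain of a local trivialization contained in `U`, the Higgs Grassmannian over `U` is the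
local model. -/
theorem exists_isPullback_restrict (U : B.Opens) (t : 𝔈.Trivialization) (h : t.V.toOpens ≤ U) :
    ∃ i, IsPullback (projToSpec (higgsGrading t.matrix) ≫ t.V.2.isoSpec.inv) i
      (B.homOfLE h) (𝔈.hgrassProj ∣_ U) := by
  have h1 := 𝔈.isPullback_chart t
  rw [← B.homOfLE_ι h] at h1
  exact ⟨_, h1.flip.of_right' (isPullback_morphismRestrict 𝔈.hgrassProj U).flip |>.flip⟩

theorem isFinite_projToSpec (U : B.Opens) (t : 𝔈.Trivialization) (h : t.V.toOpens ≤ U)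
    [IsFinite (𝔈.hgrassProj ∣_ U)] : IsFinite (projToSpec (higgsGrading t.matrix)) := by
  obtain ⟨i, hi⟩ := 𝔈.exists_isPullback_restrict U t h
  have : IsFinite (projToSpec (higgsGrading t.matrix) ≫ t.V.2.isoSpec.inv) :=
    MorphismProperty.of_isPullback hi.flip inferInstance
  exact IsFinite.comp_iff.mp this

theorem isReduced_proj (U : B.Opens) (t : 𝔈.Trivialization) (h : t.V.toOpens ≤ U)
    [AlgebraicGeometry.IsReduced (𝔈.hgrassProj ⁻¹ᵁ U).toScheme] :
    AlgebraicGeometry.IsReduced (Proj (higgsGrading t.matrix)) := by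
  obtain ⟨i, hi⟩ := 𝔈.exists_isPullback_restrict U t h
  have : IsOpenImmersion i := MorphismProperty.of_isPullback hi inferInstance
  exact isReduced_of_isOpenImmersion i

theorem isFinite_of_forall_exists (U : B.Opens) (h : ∀ x ∈ U, ∃ t : 𝔈.Trivialization,
    x ∈ t.V.toOpens ∧ t.V.toOpens ≤ U ∧ IsFinite (projToSpec (higgsGrading t.matrix))) :
    IsFinite (𝔈.hgrassProj ∣_ U) := by
  choose t ht hU hfin using fun x : U => h x.1 x.2
  have key : ∀ x : U, IsFinite (pullback.snd (𝔈.hgrassProj ∣_ U) (B.homOfLE (hU x))) := by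
    intro x
    obtain ⟨i, hi⟩ := 𝔈.exists_isPullback_restrict U (t x) (hU x)
    have := hfin x
    rw [← hi.flip.isoPullback_inv_snd]
    infer_instance
  have := isZariskiLocalAtTarget_isFinite
  exact IsZariskiLocalAtTarget.of_openCover (P := @IsFinite.{0})
    (𝒰 := 𝔈.coverOfTrivializations t hU ht) key

theorem isReduced_of_forall_exists (U : B.Opens) (h : ∀ x ∈ U, ∃ t : 𝔈.Trivialization,
    x ∈ t.V.toOpens ∧ t.V.toOpens ≤ U ∧
      AlgebraicGeometry.IsReduced (Proj (higgsGrading t.matrix))) :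
    AlgebraicGeometry.IsReduced (𝔈.hgrassProj ⁻¹ᵁ U).toScheme := by
  choose t ht hU hred using fun x : U => h x.1 x.2
  have key : ∀ x : U, AlgebraicGeometry.IsReduced
      (pullback (𝔈.hgrassProj ∣_ U) (B.homOfLE (hU x))) := by
    intro x
    obtain ⟨i, hi⟩ := 𝔈.exists_isPullback_restrict U (t x) (hU x)
    have := hred x
    exact isReduced_of_isOpenImmersion hi.flip.isoPullback.inv
  let 𝒰 := (𝔈.coverOfTrivializations t hU ht).pullback₁ (𝔈.hgrassProj ∣_ U)
  have : ∀ x, AlgebraicGeometry.IsReduced (𝒰.X x) := key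
  exact IsReduced.of_openCover _ 𝒰

end HiggsBundle
end Gluing

/-! ### Points of affine open subsets and frames -/

section Points
open TensorProduct

variable {B : Scheme.{0}}

theorem mem_basicOpen_iff_notMem_primeIdealOf {V : B.Opens} (hV : IsAffineOpen V) {x : B}
    (hx : x ∈ V) (f : Γ(B, V)) :
    x ∈ B.basicOpen f ↔ f ∉ (hV.primeIdealOf ⟨x, hx⟩).asIdeal := by
  have h1 : hV.fromSpec ⁻¹ᵁ B.basicOpen f = PrimeSpectrum.basicOpen f :=
    hV.fromSpec_preimage_basicOpen f
  calc x ∈ B.basicOpen f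
      ↔ hV.fromSpec (hV.primeIdealOf ⟨x, hx⟩) ∈ B.basicOpen f := by
        rw [hV.fromSpec_primeIdealOf ⟨x, hx⟩]
    _ ↔ f ∉ (hV.primeIdealOf ⟨x, hx⟩).asIdeal :=
        SetLike.ext_iff.mp h1 (hV.primeIdealOf ⟨x, hx⟩)

variable [B.Over (Spec (.of ℂ))]

/-- Every point of an affine open subset specializes to a closed point, whose residue field
is `ℂ`. -/
theorem exists_algHom_forall_mem_basicOpen [LocallyOfFiniteType (B ↘ Spec (.of ℂ))] {V : B.Opens}
    (hV : IsAffineOpen V) {x : B} (hx : x ∈ V) :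
    ∃ χ : Γ(B, V) →ₐ[ℂ] ℂ, ∀ f, χ f ≠ 0 → x ∈ B.basicOpen f := by
  have := finiteType_sections hV
  obtain ⟨m, hm, hle⟩ := (hV.primeIdealOf ⟨x, hx⟩).asIdeal.exists_le_maximal
    (hV.primeIdealOf ⟨x, hx⟩).isPrime.ne_top
  obtain ⟨χ, rfl⟩ := exists_algHom_ker_eq m
  exact ⟨χ, fun f hf => (mem_basicOpen_iff_notMem_primeIdealOf hV hx f).mpr fun h => hf (hle h)⟩

theorem isUnit_resFun_basicOpen {V : B.Opens} (f : Γ(B, V)) :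
    IsUnit (resFun (B.basicOpen_le f) f) :=
  RingedSpace.isUnit_res_basicOpen _ f

/-- A matrix with invertible determinant transforms a frame into a frame. -/
theorem IsFrame.of_isUnit_det {E : B.Modules} {V V' : B.Opens} {r : ℕ} {e : Fin r → Γ(E, V)}
    (he : IsFrame E e) (N : Matrix (Fin r) (Fin r) Γ(B, V)) (h : V' ≤ V)
    (hN : IsUnit (resFun h N.det)) :
    IsFrame E fun j => resSec E h (∑ i, N i j • e i) := by
  intro V'' h'
  have key := Module.Basis.is_basis_iff_det (he.basis (h'.trans h))
    (v := fun j => resSec E h' (resSec E h (∑ i, N i j • e i)))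
  refine ⟨(key.mpr ?_).1, (key.mpr ?_).2.ge⟩
  all_goals
    have h1 : (he.basis (h'.trans h)).toMatrix
        (fun j => resSec E h' (resSec E h (∑ i, N i j • e i))) =
          N.map (resFun (B := B) (h'.trans h)) := by
      ext i j
      have h2 : resSec E h' (resSec E h (∑ i, N i j • e i)) =
          ∑ i, resFun (h'.trans h) (N i j) • he.basis (h'.trans h) i := by
        rw [resSec_resSec, map_sum]
        exact Finset.sum_congr rfl fun i _ => by rw [resSec_smul, IsFrame.basis_apply]
      rw [Module.Basis.toMatrix_apply, h2, map_sum, Finsupp.finsetSum_apply]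
      simp [Finsupp.single_apply]
    rw [Module.Basis.det_apply, h1]
    have h3 : (N.map (resFun (B := B) (h'.trans h))).det = resFun h' (resFun h N.det) := by
      rw [resFun_resFun]
      exact (AlgHom.map_det (resFun (h'.trans h)) N).symm
    rw [h3]
    exact hN.map (resFun h')

end Points

/-! ### Higgs bundles of constant Jordan type -/

section Bundles
open TensorProduct

variable {B : Scheme.{0}} [B.Over (Spec (.of ℂ))] {r : ℕ}

namespace HiggsBundle

theorem φ_resSec_eq_tmul (𝔈 : HiggsBundle B r) {V V' : B.affineOpens} (h : V'.1 ≤ V.1)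
    {m : Γ(𝔈.E, V.1)} {η : Ω[Γ(B, V.1)⁄ℂ]} (hm : 𝔈.φ V m = m ⊗ₜ η) :
    𝔈.φ V' (resSec 𝔈.E h m) = resSec 𝔈.E h m ⊗ₜ formMap (resFun h) η := by
  rw [𝔈.φ_res V V' h, hm, tensorFormMap_tmul]

namespace Trivialization

variable {𝔈 : HiggsBundle B r}

/-- The trivialization over a basic open subset given by a frame and the restriction of a
generator of the sheaf of differentials. -/
noncomputable def restrictWithFrame (t : 𝔈.Trivialization) (f : Γ(B, t.V.toOpens))
    (e : Fin r → Γ(𝔈.E, B.basicOpen f)) (he : IsFrame 𝔈.E e) : 𝔈.Trivialization :=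
  ⟨t.V.basicOpen f, e, he, formMap (resFun (B.basicOpen_le f)) t.ω,
    isCoframe_formMap _ f (t.V.2.isLocalization_basicOpen f) t.isCoframe⟩

theorem matrix_eq_diagonal (t : 𝔈.Trivialization) (a : Fin r → Γ(B, t.V.toOpens))
    (h : ∀ i, 𝔈.φ ⟨t.V.toOpens, t.V.2⟩ (t.e i) = t.e i ⊗ₜ (a i • t.ω)) :
    t.matrix = Matrix.diagonal a := by
  have hb : ∀ i, t.isFrame.basis le_rfl i = t.e i := fun i => by
    rw [IsFrame.basis_apply, resSec_self]
  refine Matrix.ext fun i j => ?_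
  refine congrFun (coeff_eq_of_sum_eq (t.isFrame.basis le_rfl) t.isCoframe
    (fun i => t.matrix i j) (fun i => Matrix.diagonal a i j) ?_) i
  rw [matrix, ← higgsMatrix_spec, hb, h, Finset.sum_eq_single j]
  · rw [Matrix.diagonal_apply_eq, hb, TensorProduct.tmul_smul]
  · intro i _ hij
    rw [Matrix.diagonal_apply_ne _ hij, zero_smul]
  · simp

/-- A vector which is an eigenvector for the matrix of the Higgs field is the coordinate vector of
an eigensection. -/
theorem φ_sum_smul (t : 𝔈.Trivialization) {z : Fin r → Γ(B, t.V.toOpens)} {c : Γ(B, t.V.toOpens)}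
    (hz : t.matrix.mulVec z = c • z) :
    𝔈.φ ⟨t.V.toOpens, t.V.2⟩ (∑ i, z i • t.e i) = (∑ i, z i • t.e i) ⊗ₜ (c • t.ω) := by
  have hb : ∀ i, t.isFrame.basis le_rfl i = t.e i := fun i => by
    rw [IsFrame.basis_apply, resSec_self]
  have h1 : ∀ j, 𝔈.φ ⟨t.V.toOpens, t.V.2⟩ (t.e j) = ∑ i, t.matrix i j • (t.e i ⊗ₜ t.ω) := by
    intro j
    have := higgsMatrix_spec (𝔈.φ ⟨t.V.toOpens, t.V.2⟩) (t.isFrame.basis le_rfl) t.isCoframe j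
    simp only [hb] at this
    exact this
  rw [map_sum, TensorProduct.sum_tmul]
  simp only [map_smul, h1, Finset.smul_sum, smul_smul]
  rw [Finset.sum_comm]
  refine Finset.sum_congr rfl fun i _ => ?_
  rw [← Finset.sum_smul, TensorProduct.tmul_smul, ← TensorProduct.smul_tmul', smul_smul]
  congr 1
  have := congrFun hz i
  rw [Matrix.mulVec, dotProduct] at this
  rw [← smul_eq_mul c, ← Pi.smul_apply, ← this]
  exact Finset.sum_congr rfl fun j _ => mul_comm _ _

end Trivialization

variable {𝔈 : HiggsBundle B r} {U : B.Opens} {T : JordanType} {eig : Fin T.s → DifferentialForm U}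

/-- The coefficients of the eigenvalues with respect to the generator of the sheaf of differentials
of a local trivialization. -/
noncomputable def eigenCoeff (t : 𝔈.Trivialization) (ht : t.V.toOpens ≤ U)
    (eig : Fin T.s → DifferentialForm U) (v : Fin T.s) : Γ(B, t.V.toOpens) :=
  t.isCoframe.basis.repr ((eig v).val ⟨t.V.toOpens, t.V.2⟩ ht) ()

theorem HasConstantJordanType.hasJordanType (hT : 𝔈.HasConstantJordanType U T eig)
    (t : 𝔈.Trivialization) (ht : t.V.toOpens ≤ U) :
    HasJordanType t.matrix T (eigenCoeff t ht eig) :=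
  hT t ht

variable [SmoothOfRelativeDimension 1 (B ↘ Spec (.of ℂ))]

theorem exists_trivialization_le (𝔈 : HiggsBundle B r) {U : B.Opens} {x : B} (hx : x ∈ U) :
    ∃ t : 𝔈.Trivialization, x ∈ t.V.toOpens ∧ t.V.toOpens ≤ U := by
  obtain ⟨t, hxt⟩ := 𝔈.exists_trivialization x
  obtain ⟨f, hfU, hxf⟩ := t.V.2.exists_basicOpen_le ⟨x, hx⟩ hxt
  exact ⟨t.restrictWithFrame f _ (t.isFrame.res (B.basicOpen_le f)), hxf, hfU⟩

theorem locallyOfFiniteType_of_smooth : LocallyOfFiniteType (B ↘ Spec (.of ℂ)) := by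
  have : Smooth (B ↘ Spec (.of ℂ)) := SmoothOfRelativeDimension.smooth 1 _
  infer_instance

theorem HasConstantJordanType.isFinite_iff (hT : 𝔈.HasConstantJordanType U T eig)
    (hU : (U : Set B).Nonempty) :
    IsFinite (𝔈.hgrassProj ∣_ U) ↔ Function.Injective fun b : T.Block => eig b.1 := by
  have := locallyOfFiniteType_of_smooth (B := B)
  constructor
  · intro hfin
    obtain ⟨x, hx⟩ := hU
    obtain ⟨t, hxt, ht⟩ := 𝔈.exists_trivialization_le hx
    obtain ⟨χ, -⟩ := exists_algHom_forall_mem_basicOpen t.V.2 hxt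
    have := 𝔈.isFinite_projToSpec U t ht
    have h := hT.hasJordanType t ht
    intro b b' hb
    -- distinct eigenvalues are distinct forms, as they differ at the closed point given by `χ`
    refine h.injective_of_isFinite_projToSpec χ ((h χ).1 ?_)
    simp only [eigenCoeff, show eig b.1 = eig b'.1 from hb]
  · intro hinj
    refine 𝔈.isFinite_of_forall_exists U fun x hx => ?_
    obtain ⟨t, hxt, ht⟩ := 𝔈.exists_trivialization_le hx
    have := finiteType_sections t.V.2
    exact ⟨t, hxt, ht, (hT.hasJordanType t ht).isFinite_projToSpec
      fun b b' hb => hinj (congrArg eig hb)⟩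

theorem HasConstantJordanType.isDiagonalizableOn (hT : 𝔈.HasConstantJordanType U T eig)
    [AlgebraicGeometry.IsReduced (𝔈.hgrassProj ⁻¹ᵁ U).toScheme] : 𝔈.IsDiagonalizableOn U := by
  have := locallyOfFiniteType_of_smooth (B := B)
  have := isReduced_of_smoothOfRelativeDimension (B := B) 1
  intro x hx
  obtain ⟨t, hxt, ht⟩ := 𝔈.exists_trivialization_le hx
  have := finiteType_sections t.V.2
  have := 𝔈.isReduced_proj U t ht
  have h := hT.hasJordanType t ht
  obtain ⟨χ, hχ⟩ := exists_algHom_forall_mem_basicOpen t.V.2 hxt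
  obtain ⟨N, σ, hN, hσ⟩ := h.exists_eigenmatrix (h.blockSize_eq_one_of_isReduced_proj χ) χ
  have hle := B.basicOpen_le N.det
  exact ⟨⟨B.basicOpen N.det, t.V.2.basicOpen _⟩, hχ _ hN, hle.trans ht, _,
    t.isFrame.of_isUnit_det N hle (isUnit_resFun_basicOpen _), _,
    fun j => 𝔈.φ_resSec_eq_tmul (V := ⟨t.V.toOpens, t.V.2⟩) hle (t.φ_sum_smul (hσ j))⟩

theorem HasConstantJordanType.isReduced (hT : 𝔈.HasConstantJordanType U T eig)
    (h𝔈 : 𝔈.IsDiagonalizableOn U) :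
    AlgebraicGeometry.IsReduced (𝔈.hgrassProj ⁻¹ᵁ U).toScheme := by
  have := locallyOfFiniteType_of_smooth (B := B)
  have := isReduced_of_smoothOfRelativeDimension (B := B) 1
  refine 𝔈.isReduced_of_forall_exists U fun x hx => ?_
  obtain ⟨V, hxV, hVU, e, he, ω, hω⟩ := h𝔈 x hx
  obtain ⟨u, hxu, -⟩ := 𝔈.exists_trivialization_le hx
  -- `t` has the given eigenframe, over a subset where the differentials have a generator
  obtain ⟨f, g, hfg, hxf⟩ := exists_basicOpen_le_affine_inter u.V.2 V.2 x ⟨hxu, hxV⟩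
  have hfV : B.basicOpen f ≤ V.1 := hfg ▸ B.basicOpen_le g
  let t := u.restrictWithFrame f _ (he.res hfV)
  have htU : t.V.toOpens ≤ U := hfV.trans hVU
  obtain ⟨a, ha⟩ : ∃ a : Fin r → Γ(B, t.V.toOpens), ∀ i, a i • t.ω = formMap (resFun hfV) (ω i) :=
    ⟨_, fun i => (t.isCoframe.2 (formMap (resFun hfV) (ω i))).choose_spec⟩
  have hφ : ∀ i, 𝔈.φ ⟨t.V.toOpens, t.V.2⟩ (t.e i) = t.e i ⊗ₜ (a i • t.ω) := fun i => by
    rw [ha]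
    exact 𝔈.φ_resSec_eq_tmul (V' := ⟨t.V.toOpens, t.V.2⟩) hfV (hω i)
  have h := hT.hasJordanType t htU
  rw [t.matrix_eq_diagonal a hφ] at h
  have := finiteType_sections t.V.2
  have hxt : x ∈ t.V.toOpens := hxf
  obtain ⟨g, σ, hg, hgσ⟩ := h.exists_mul_sub_eq_zero (t.V.2.primeIdealOf ⟨x, hxt⟩).asIdeal
    (hq := (t.V.2.primeIdealOf ⟨x, hxt⟩).isPrime)
  have hle := B.basicOpen_le g
  -- where `g` is invertible, the diagonal entries `a i` are equal to eigenvalues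
  let t' := t.restrictWithFrame g _ (t.isFrame.res hle)
  let c : Fin r → Γ(B, t'.V.toOpens) := fun i => resFun hle (eigenCoeff t htU eig (σ i))
  have hc : ∀ i, resFun hle (a i) = c i := fun i => by
    have := congrArg (resFun hle) (hgσ i)
    rw [map_mul, map_zero, (isUnit_resFun_basicOpen g).mul_right_eq_zero, map_sub, sub_eq_zero]
      at this
    exact this
  have hφ' : ∀ i, 𝔈.φ ⟨t'.V.toOpens, t'.V.2⟩ (t'.e i) = t'.e i ⊗ₜ (c i • t'.ω) := fun i => by
    rw [← hc]
    refine (𝔈.φ_resSec_eq_tmul (V' := ⟨t'.V.toOpens, t'.V.2⟩) hle (hφ i)).trans ?_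
    exact congrArg (t'.e i ⊗ₜ ·) (formMap_smul (resFun hle) (a i) t.ω)
  refine ⟨t', (mem_basicOpen_iff_notMem_primeIdealOf t.V.2 hxt g).mpr hg, hle.trans htU, ?_⟩
  rw [t'.matrix_eq_diagonal _ hφ']
  have : _root_.IsReduced (HiggsRing (Matrix.diagonal c)) := by
    have h3 : _root_.IsReduced Γ(B, B.basicOpen g) := inferInstance
    refine isReduced_higgsRing_diagonal _ fun i j => ?_
    by_cases hij : σ i = σ j
    · exact .inl (congrArg (fun v => resFun hle (eigenCoeff t htU eig v)) hij)
    · refine .inr ?_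
      have := (h.isUnit_sub hij).map (resFun hle)
      rwa [map_sub] at this
  exact _root_.isReduced_proj _

end HiggsBundle
end Bundles

theorem mainTheorem9 (B : Scheme.{0}) [B.Over (Spec (.of ℂ))]
    [SmoothOfRelativeDimension 1 (B ↘ Spec (.of ℂ))] (r : ℕ) (𝔈 : HiggsBundle B r)
    (U : B.Opens) (hU : (U : Set B).Nonempty) (T : JordanType)
    (eig : Fin T.s → DifferentialForm U) (hT : 𝔈.HasConstantJordanType U T eig) :
    (IsFinite (𝔈.hgrassProj ∣_ U) ↔ Function.Injective fun b : T.Block => eig b.1) ∧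
      (AlgebraicGeometry.IsReduced (𝔈.hgrassProj ⁻¹ᵁ U).toScheme ↔ 𝔈.IsDiagonalizableOn U) :=
  ⟨hT.isFinite_iff hU, fun _ => hT.isDiagonalizableOn, hT.isReduced⟩
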